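/- Let $g\in W^{1,1}(\mathbb R^n)$ be real-valued (i.e. $g\in L^1$ and its weak partial derivatives $\partial_i g$ are in $L^1$), and let $\mathbf u_0:\mathbb R^n\to\mathbb R^n$ be $C^1$ and bounded. Consider the initial value problem $$\mathbf u_t+\bar{\mathbf u}\cdot\nabla\mathbf u=0,\qquad \bar{\mathbf u}=g*\mathbf u,\qquad \mathbf u(\cdot,0)=\mathbf u_0 \qquad (1)$$ on $\mathbb R^n\times[0,\infty)$, where the convolution is in $x$. A *global solution* is a function $\mathbf u\in C^1(\mathbb R^n\times[0,\infty);\mathbb R^n)$ which satisfies (1) at every point and is bounded on $\mathbb R^n\times[0,T]$ for every $T<\infty$. (a) A global solution exists. (b) If moreover $\nabla\mathbf u_0$ is bounded, then the global solution is unique, and $\nabla\mathbf u$ is bounded on $\mathbb R^n\times[0,T]$ for every $T<\infty$. (c) Every global solution $\mathbf u$ has the following properties. There is a $C^1$ flow $\phi$ of $\bar{\mathbf u}$, that is, $\partial_t\phi(\xi,t)=\bar{\mathbf u}(\phi(\xi,t),t)$ and $\phi(\xi,0)=\xi$ for all $\xi\in\mathbb R^n$, $t\ge0$; each $\phi(\cdot,t)$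 is a bijection of $\mathbb R^n$ with nonzero Jacobian determinant everywhere, the inverse $\phi^{-1}(x,t)$ is $C^1$ on $\mathbb R^n\times[0,\infty)$, and $$\mathbf u(x,t)=\mathbf u_0(\phi^{-1}(x,t)).$$ For all $t\ge 0$ and all $j$, $\|\mathbf u(\cdot,t)\|_{L^\infty}=\|\mathbf u_0\|_{L^\infty}$ and $\|u_j(\cdot,t)\|_{L^\infty}=\|u_{0,j}\|_{L^\infty}$. For all $t\ge 0$, $\bar{\mathbf u}(\cdot,t)$ is $C^1$ and, for all $i,j$, $$\|\partial_i\bar{\mathbf u}(\cdot,t)\|_{L^\infty}\le\|\partial_i g\|_{L^1}\,\|\mathbf u_0\|_{L^\infty},\qquad \|\partial_i\bar u_j(\cdot,t)\|_{L^\infty}\le\|\partial_i g\|_{L^1}\,\|u_{0,j}\|_{L^\infty}.$$ -/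

import Mathlib

open MeasureTheory Set
open scoped ContDiff ENNReal

/-- Euclidean space `ℝⁿ`. -/
abbrev RSpace (n : ℕ) : Type := EuclideanSpace ℝ (Fin n)

/-- The `i`-th standard basis vector of `ℝⁿ`. -/
noncomputable def basisVec {n : ℕ} (i : Fin n) : RSpace n := EuclideanSpace.single i (1 : ℝ)

/-- The integrable function `h` is the weak partial derivative `∂ᵢ g` of `g`:
`∫ g ∂ᵢψ = - ∫ h ψ` for all smooth compactly supported `ψ`. -/
def IsWeakPartial {n : ℕ} (g : RSpace n → ℝ) (i : Fin n) (h : RSpace n → ℝ) : Prop :=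
  Integrable h volume ∧
    ∀ ψ : RSpace n → ℝ, ContDiff ℝ ∞ ψ → HasCompactSupport ψ →
      ∫ x, g x * fderiv ℝ ψ x (basisVec i) = -∫ x, h x * ψ x

/-- The Sobolev space `W^{1,1}(ℝⁿ)`: `g` and all its weak first partial derivatives are in `L¹`. -/
def MemW11 {n : ℕ} (g : RSpace n → ℝ) : Prop :=
  Integrable g volume ∧ ∀ i : Fin n, ∃ h : RSpace n → ℝ, IsWeakPartial g i h

/-- The filtered field `g ∗ w`, i.e. `x ↦ ∫ g(y) w(x - y) dy`. -/
noncomputable def filtered {n : ℕ} (g : RSpace n → ℝ) (w : RSpace n → RSpace n) :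
    RSpace n → RSpace n :=
  convolution g w (ContinuousLinearMap.lsmul ℝ ℝ) volume

/-- A field on `[0,∞) × ℝⁿ` (time first) is `C¹`, up to and including `t = 0`. -/
def IsC1 {n : ℕ} (u : ℝ → RSpace n → RSpace n) : Prop :=
  ContDiffOn ℝ 1 (fun p : ℝ × RSpace n => u p.1 p.2) (Ici (0 : ℝ) ×ˢ univ)

/-- `u` is a global `C¹` solution of `u_t + ū·∇u = 0`, `ū = g ∗ u`, `u(·,0) = u₀`, bounded on
`[0,T] × ℝⁿ` for every finite `T`. The time derivative at `t = 0` is the one-sided one. The `j`-th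
component of `fderiv ℝ (u t) x (ū x)` is `∑ᵢ ūᵢ ∂ᵢ uⱼ`. -/
structure IsGlobalSolution {n : ℕ} (g : RSpace n → ℝ) (u₀ : RSpace n → RSpace n)
    (u : ℝ → RSpace n → RSpace n) : Prop where
  c1 : IsC1 u
  bounded : ∀ T : ℝ, ∃ M : ℝ, ∀ t ∈ Icc 0 T, ∀ x, ‖u t x‖ ≤ M
  equation : ∀ t : ℝ, 0 ≤ t → ∀ x : RSpace n,
    HasDerivWithinAt (fun s => u s x) (-(fderiv ℝ (u t) x (filtered g (u t) x))) (Ici 0) t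
  initial : ∀ x, u 0 x = u₀ x

/-- `φ` is the flow of the time-dependent velocity field `v` started at time `0`:
`φ(ξ,0) = ξ` and `∂ₜ φ(ξ,t) = v(φ(ξ,t),t)` for `t ≥ 0`. -/
structure IsFlow {n : ℕ} (v φ : ℝ → RSpace n → RSpace n) : Prop where
  initial : ∀ ξ, φ 0 ξ = ξ
  velocity : ∀ t : ℝ, 0 ≤ t → ∀ ξ : RSpace n,
    HasDerivWithinAt (fun s => φ s ξ) (v t (φ t ξ)) (Ici 0) t

/-! Along a characteristic of `ū` the equation says that `u` is constant, so `u(·,t)` is `u₀`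
composed with the inverse flow, and every sup norm is inherited from `u₀`. The derivative of `ū = g
∗ u` falls on `g`: `∂ᵢū = ∂ᵢg ∗ u` is bounded by `‖∂ᵢg‖₁ ‖u₀‖∞`. Hence `ū` is Lipschitz in space
with a constant known in advance, and its flow is global, invertible and `C¹`.

For existence, `∇u₀` may be unbounded, so a contraction argument for `u` is not at hand; compactness
is used instead. If the velocity at time `t` is computed from the field at time `t - ε`, the problem
is solved exactly by finitely many iterations on a bounded time interval (`retardedIter_succ_eq`).
The backward flows have a modulus of continuity independent of `ε` (`dist_backFlow_le_of_bounded`),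
so a subsequence converges pointwise as `ε → 0`. Dominated convergence passes to the limit in the
convolution, and `tendsto_backFlow` identifies the limit map as the backward flow of the limit
velocity.

For uniqueness, let `w` be a second solution. Along a characteristic of `u` the difference `w - u`
has derivative `∇w · (ū - w̄)`. A bound on `∇w` makes this at most a constant times the sup of `w -
u`; iterating gives `2M (Ct)^k / k!`, which tends to `0`.

Smoothness is obtained throughout from continuous slope functions, `f y - f x = S x y (y - x)`.
Slopes compose, invert and pass to limits as exact identities. -/

/-! ### Ordinary differential equations with globally Lipschitz fields. -/

section ODE

open Filter Topology NNReal

variable {F : Type*} [NormedAddCommGroup F] [NormedSpace ℝ F]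

/-- Since `1 - Kx ≤ exp (-Kx)`, one has `exp (Kx) - 1 ≤ Kx exp (Kx)`. This removes the division by
`K`, so `K = 0` needs no separate treatment later. -/
theorem gronwallBound_le_mul_exp {δ ε x : ℝ} {K : ℝ≥0} (hε : 0 ≤ ε) :
    gronwallBound δ K ε x ≤ (δ + ε * x) * Real.exp (K * x) := by
  rcases eq_or_ne (K : ℝ) 0 with hK | hK
  · rw [hK, gronwallBound_K0]; simp
  · rw [gronwallBound_of_K_ne_0 hK]
    have hK' : (0 : ℝ) < K := lt_of_le_of_ne K.2 (Ne.symm hK)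
    have h1 : Real.exp (K * x) - 1 ≤ K * x * Real.exp (K * x) := by
      have := Real.add_one_le_exp (-(K * x))
      have h2 : Real.exp (-(K * x)) * Real.exp (K * x) = 1 := by rw [← Real.exp_add]; simp
      nlinarith [Real.exp_pos (K * x)]
    have h3 : ε / K * (Real.exp (K * x) - 1) ≤ ε / K * (K * x * Real.exp (K * x)) := by gcongr
    have h4 : ε / K * (K * x * Real.exp (K * x)) = ε * x * Real.exp (K * x) := by field_simp
    linarith

/-- Grönwall's inequality for approximate solutions, forwards from the initial time. -/
theorem dist_le_of_approx_solution_right {f : ℝ → F → F} {K : ℝ≥0} {a b t₀ ε η : ℝ}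
    {X Y X' Y' : ℝ → F} (hf : ∀ t ∈ Icc a b, LipschitzWith K (f t)) (ht₀ : t₀ ∈ Icc a b)
    (hX : ∀ t ∈ Icc a b, HasDerivWithinAt X (X' t) (Icc a b) t)
    (hY : ∀ t ∈ Icc a b, HasDerivWithinAt Y (Y' t) (Icc a b) t)
    (bX : ∀ t ∈ Icc a b, dist (X' t) (f t (X t)) ≤ ε)
    (bY : ∀ t ∈ Icc a b, dist (Y' t) (f t (Y t)) ≤ η) {t : ℝ} (ht : t ∈ Icc t₀ b) :
    dist (X t) (Y t) ≤ (dist (X t₀) (Y t₀) + (ε + η) * (b - a)) * Real.exp (K * (b - a)) := by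
  have hsub : ∀ s ∈ Ico t₀ b, s ∈ Icc a b := fun s hs => ⟨ht₀.1.trans hs.1, hs.2.le⟩
  have hsub' : Icc t₀ b ⊆ Icc a b := fun s hs => ⟨ht₀.1.trans hs.1, hs.2⟩
  have hε : 0 ≤ ε + η := add_nonneg (dist_nonneg.trans (bX _ ht₀)) (dist_nonneg.trans (bY _ ht₀))
  have hder : ∀ {Z Z' : ℝ → F}, (∀ t ∈ Icc a b, HasDerivWithinAt Z (Z' t) (Icc a b) t) →
      ∀ s ∈ Ico t₀ b, HasDerivWithinAt Z (Z' s) (Ici s) s := by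
    intro Z Z' hZ s hs
    exact (hZ s (hsub s hs)).mono_of_mem_nhdsWithin
      (Icc_mem_nhdsGE_of_mem ⟨ht₀.1.trans hs.1, hs.2⟩)
  have := dist_le_of_approx_trajectories_ODE_of_mem (v := f) (s := fun _ => univ) (K := K)
    (a := t₀) (b := b) (fun s hs => (hf s (hsub s hs)).lipschitzOnWith)
    (fun s hs => ((hX s (hsub' hs)).continuousWithinAt.mono hsub')) (hder hX)
    (fun s hs => bX s (hsub s hs)) (fun _ _ => trivial)
    (fun s hs => ((hY s (hsub' hs)).continuousWithinAt.mono hsub')) (hder hY)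
    (fun s hs => bY s (hsub s hs)) (fun _ _ => trivial) le_rfl t ht
  refine this.trans ((gronwallBound_le_mul_exp hε).trans ?_)
  have h1 : t - t₀ ≤ b - a := by linarith [ht.2, ht₀.1]
  have h0 : 0 ≤ t - t₀ := sub_nonneg.2 ht.1
  have h2 : 0 ≤ (ε + η) * (b - a) := mul_nonneg hε (h0.trans h1)
  have h3 : (0 : ℝ) ≤ K := K.2
  have h4 : 0 ≤ dist (X t₀) (Y t₀) + (ε + η) * (b - a) := add_nonneg dist_nonneg h2
  gcongr

/-- Grönwall's inequality for approximate solutions, in both directions from the initial time. -/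
theorem dist_le_of_approx_solution {f : ℝ → F → F} {K : ℝ≥0} {a b t₀ ε η : ℝ}
    {X Y X' Y' : ℝ → F} (hf : ∀ t ∈ Icc a b, LipschitzWith K (f t)) (ht₀ : t₀ ∈ Icc a b)
    (hX : ∀ t ∈ Icc a b, HasDerivWithinAt X (X' t) (Icc a b) t)
    (hY : ∀ t ∈ Icc a b, HasDerivWithinAt Y (Y' t) (Icc a b) t)
    (bX : ∀ t ∈ Icc a b, dist (X' t) (f t (X t)) ≤ ε)
    (bY : ∀ t ∈ Icc a b, dist (Y' t) (f t (Y t)) ≤ η) {t : ℝ} (ht : t ∈ Icc a b) :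
    dist (X t) (Y t) ≤ (dist (X t₀) (Y t₀) + (ε + η) * (b - a)) * Real.exp (K * (b - a)) := by
  rcases le_total t₀ t with h | h
  · exact dist_le_of_approx_solution_right hf ht₀ hX hY bX bY ⟨h, ht.2⟩
  -- Reversing time replaces `f` by `-f (-s)`, which has the same Lipschitz constant, and reduces to
  -- the forward case.
  · have hm : ∀ s ∈ Icc (-b) (-a), -s ∈ Icc a b := fun s hs => ⟨by linarith [hs.2], by linarith [hs.1]⟩
    have hd : ∀ {Z Z' : ℝ → F}, (∀ t ∈ Icc a b, HasDerivWithinAt Z (Z' t) (Icc a b) t) →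
        ∀ s ∈ Icc (-b) (-a), HasDerivWithinAt (fun s => Z (-s)) (-Z' (-s)) (Icc (-b) (-a)) s := by
      intro Z Z' hZ s hs
      have := (hZ (-s) (hm s hs)).scomp s (hasDerivAt_neg s).hasDerivWithinAt (fun s hs => hm s hs)
      simpa [Function.comp_def] using this
    have := dist_le_of_approx_solution_right (f := fun s x => -f (-s) x) (K := K) (a := -b) (b := -a)
      (t₀ := -t₀) (ε := ε) (η := η) (t := -t) (fun s hs => (hf _ (hm s hs)).neg)
      ⟨by linarith [ht₀.2], by linarith [ht₀.1]⟩ (hd hX) (hd hY)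
      (fun s hs => by rw [dist_neg_neg]; exact bX _ (hm s hs))
      (fun s hs => by rw [dist_neg_neg]; exact bY _ (hm s hs))
      ⟨by linarith, by linarith [ht.1]⟩
    simp only [neg_neg] at this
    convert this using 2 <;> ring_nf

theorem dist_le_of_solution {f : ℝ → F → F} {K : ℝ≥0} {a b t₀ : ℝ}
    {X Y : ℝ → F} (hf : ∀ t ∈ Icc a b, LipschitzWith K (f t)) (ht₀ : t₀ ∈ Icc a b)
    (hX : ∀ t ∈ Icc a b, HasDerivWithinAt X (f t (X t)) (Icc a b) t)
    (hY : ∀ t ∈ Icc a b, HasDerivWithinAt Y (f t (Y t)) (Icc a b) t) {t : ℝ} (ht : t ∈ Icc a b) :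
    dist (X t) (Y t) ≤ dist (X t₀) (Y t₀) * Real.exp (K * (b - a)) := by
  simpa using dist_le_of_approx_solution hf ht₀ hX hY (ε := 0) (η := 0) (by simp) (by simp) ht

theorem solution_unique {f : ℝ → F → F} {K : ℝ≥0} {a b t₀ : ℝ}
    {X Y : ℝ → F} (hf : ∀ t ∈ Icc a b, LipschitzWith K (f t)) (ht₀ : t₀ ∈ Icc a b)
    (hX : ∀ t ∈ Icc a b, HasDerivWithinAt X (f t (X t)) (Icc a b) t)
    (hY : ∀ t ∈ Icc a b, HasDerivWithinAt Y (f t (Y t)) (Icc a b) t) (h0 : X t₀ = Y t₀)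
    {t : ℝ} (ht : t ∈ Icc a b) : X t = Y t := by
  have := dist_le_of_solution hf ht₀ hX hY ht
  rw [h0, dist_self, zero_mul] at this
  exact dist_le_zero.1 this

theorem solution_unique_global {f : ℝ → F → F} {K : ℝ≥0} {t₀ : ℝ}
    {X Y : ℝ → F} (hf : ∀ t, LipschitzWith K (f t))
    (hX : ∀ t, HasDerivAt X (f t (X t)) t) (hY : ∀ t, HasDerivAt Y (f t (Y t)) t)
    (h0 : X t₀ = Y t₀) (t : ℝ) : X t = Y t :=
  solution_unique (a := min t₀ t) (b := max t₀ t) (fun s _ => hf s) ⟨by simp, by simp⟩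
    (fun s _ => (hX s).hasDerivWithinAt) (fun s _ => (hY s).hasDerivWithinAt) h0 ⟨by simp, by simp⟩

/-- A time step that depends on the Lipschitz constant only. -/
theorem exists_solution_short [CompleteSpace F] {f : ℝ → F → F} {K : ℝ≥0}
    (hf : ∀ t, LipschitzWith K (f t)) (hc : ∀ x, Continuous fun t => f t x) {τ : ℝ} (hτ : 0 ≤ τ)
    (hKτ : K * τ ≤ 1 / 2) (t₀ : ℝ) (x₀ : F) :
    ∃ X : ℝ → F, X t₀ = x₀ ∧
      ∀ t ∈ Icc (t₀ - τ) (t₀ + τ), HasDerivWithinAt X (f t (X t)) (Icc (t₀ - τ) (t₀ + τ)) t := by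
  obtain ⟨C, hC⟩ := (isCompact_Icc (a := t₀ - τ) (b := t₀ + τ)).exists_bound_of_continuousOn
    (hc x₀).continuousOn
  have hm : t₀ ∈ Icc (t₀ - τ) (t₀ + τ) := ⟨by linarith, by linarith⟩
  have hC0 : 0 ≤ C := (norm_nonneg _).trans (hC t₀ hm)
  -- With `C` bounding the field at `x₀`, the field on the ball of radius `2Cτ` is at most `C +
  -- K(2Cτ) ≤ 2C`, so in time `τ` the solution cannot leave that ball.
  have hpl : IsPicardLindelof f (tmin := t₀ - τ) (tmax := t₀ + τ) ⟨t₀, hm⟩ x₀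
      (⟨2 * C * τ, by positivity⟩ : ℝ≥0) 0 (⟨C + K * (2 * C * τ), by positivity⟩ : ℝ≥0) K := by
    refine ⟨fun t _ => (hf t).lipschitzOnWith, fun x _ => (hc x).continuousOn, ?_, ?_⟩
    · intro t ht x hx
      have h1 := (hf t).dist_le_mul x x₀
      rw [dist_eq_norm] at h1
      have h2 : dist x x₀ ≤ 2 * C * τ := hx
      have h3 : (K : ℝ) * dist x x₀ ≤ K * (2 * C * τ) := by gcongr
      have h4 := norm_le_norm_add_norm_sub' (f t x) (f t x₀)
      change _ ≤ C + K * (2 * C * τ)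
      linarith [hC t ht]
    · have : max (t₀ + τ - t₀) (t₀ - (t₀ - τ)) = τ := by simp
      change (C + K * (2 * C * τ)) * max (t₀ + τ - t₀) (t₀ - (t₀ - τ)) ≤ 2 * C * τ - 0
      rw [this]
      nlinarith [mul_nonneg hC0 hτ]
  obtain ⟨X, h0, hX⟩ := hpl.exists_eq_forall_mem_Icc_hasDerivWithinAt₀
  exact ⟨X, h0, hX⟩

theorem solution_concat {f : ℝ → F → F} {a b c : ℝ} (hab : a ≤ b) (hbc : b ≤ c)
    {X Y : ℝ → F} (hX : ∀ t ∈ Icc a b, HasDerivWithinAt X (f t (X t)) (Icc a b) t)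
    (hY : ∀ t ∈ Icc b c, HasDerivWithinAt Y (f t (Y t)) (Icc b c) t) (h : X b = Y b) :
    ∃ Z : ℝ → F, EqOn Z X (Icc a b) ∧ EqOn Z Y (Icc b c) ∧
      ∀ t ∈ Icc a c, HasDerivWithinAt Z (f t (Z t)) (Icc a c) t := by
  classical
  let Z : ℝ → F := fun t => if t ≤ b then X t else Y t
  have hZX : EqOn Z X (Icc a b) := fun t ht => if_pos ht.2
  have hZY : EqOn Z Y (Icc b c) := by
    intro t ht
    rcases eq_or_lt_of_le ht.1 with rfl | hlt
    · simp [Z, h]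
    · simp [Z, not_le.2 hlt]
  refine ⟨Z, hZX, hZY, fun t ht => ?_⟩
  rw [← Icc_union_Icc_eq_Icc hab hbc]
  have h1 : HasDerivWithinAt Z (f t (Z t)) (Icc a b) t := by
    by_cases hm : t ∈ Icc a b
    · rw [hZX hm]; exact (hX t hm).congr hZX (hZX hm)
    · exact HasFDerivWithinAt.of_notMem_closure (by rwa [closure_Icc])
  have h2 : HasDerivWithinAt Z (f t (Z t)) (Icc b c) t := by
    by_cases hm : t ∈ Icc b c
    · rw [hZY hm]; exact (hY t hm).congr hZY (hZY hm)
    · exact HasFDerivWithinAt.of_notMem_closure (by rwa [closure_Icc])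
  exact h1.union h2

/-- The step `τ` does not depend on the position, so a solution can be prolonged by `τ` at both ends
any number of times. -/
theorem exists_solution_Icc [CompleteSpace F] {f : ℝ → F → F} {K : ℝ≥0}
    (hf : ∀ t, LipschitzWith K (f t)) (hc : ∀ x, Continuous fun t => f t x) {τ : ℝ} (hτ : 0 ≤ τ)
    (hKτ : K * τ ≤ 1 / 2) (t₀ : ℝ) (x₀ : F) (n : ℕ) :
    ∃ X : ℝ → F, X t₀ = x₀ ∧ ∀ t ∈ Icc (t₀ - n * τ) (t₀ + n * τ),
      HasDerivWithinAt X (f t (X t)) (Icc (t₀ - n * τ) (t₀ + n * τ)) t := by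
  induction n with
  | zero =>
    refine ⟨fun _ => x₀, rfl, fun t ht => ?_⟩
    simp only [CharP.cast_eq_zero, zero_mul, sub_zero, add_zero, Icc_self] at ht ⊢
    rw [mem_singleton_iff.1 ht]
    exact HasFDerivWithinAt.of_subsingleton subsingleton_singleton
  | succ n ih =>
    obtain ⟨X, h0, hX⟩ := ih
    have hn : 0 ≤ n * τ := by positivity
    obtain ⟨Y, hY0, hY⟩ := exists_solution_short hf hc hτ hKτ (t₀ + n * τ) (X (t₀ + n * τ))
    obtain ⟨Z, hZ0, hZ⟩ := exists_solution_short hf hc hτ hKτ (t₀ - n * τ) (X (t₀ - n * τ))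
    have hY' : ∀ t ∈ Icc (t₀ + n * τ) (t₀ + (n + 1 : ℕ) * τ),
        HasDerivWithinAt Y (f t (Y t)) (Icc (t₀ + n * τ) (t₀ + (n + 1 : ℕ) * τ)) t := by
      have hs : Icc (t₀ + n * τ) (t₀ + (n + 1 : ℕ) * τ) ⊆
          Icc (t₀ + n * τ - τ) (t₀ + n * τ + τ) := by
        apply Icc_subset_Icc <;> push_cast <;> linarith
      exact fun t ht => (hY t (hs ht)).mono hs
    have hZ' : ∀ t ∈ Icc (t₀ - (n + 1 : ℕ) * τ) (t₀ - n * τ),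
        HasDerivWithinAt Z (f t (Z t)) (Icc (t₀ - (n + 1 : ℕ) * τ) (t₀ - n * τ)) t := by
      have hs : Icc (t₀ - (n + 1 : ℕ) * τ) (t₀ - n * τ) ⊆
          Icc (t₀ - n * τ - τ) (t₀ - n * τ + τ) := by
        apply Icc_subset_Icc <;> push_cast <;> linarith
      exact fun t ht => (hZ t (hs ht)).mono hs
    obtain ⟨U, hUX, -, hU⟩ := solution_concat (by linarith) (by push_cast; linarith) hX hY' hY0.symm
    obtain ⟨W, -, hWU, hW⟩ := solution_concat (by push_cast; linarith)
      (by push_cast; linarith) hZ' hU (by rw [hZ0, hUX ⟨le_rfl, by linarith⟩])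
    refine ⟨W, ?_, hW⟩
    rw [hWU ⟨by linarith, by push_cast; linarith⟩, hUX ⟨by linarith, by linarith⟩, h0]

/-- Global solvability of ordinary differential equations with a globally Lipschitz field. -/
theorem exists_solution_global [CompleteSpace F] {f : ℝ → F → F} {K : ℝ≥0}
    (hf : ∀ t, LipschitzWith K (f t)) (hc : ∀ x, Continuous fun t => f t x) (t₀ : ℝ) (x₀ : F) :
    ∃ X : ℝ → F, X t₀ = x₀ ∧ ∀ t, HasDerivAt X (f t (X t)) t := by
  set τ : ℝ := 1 / (2 * (K + 1)) with hτdef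
  have hK : (0 : ℝ) ≤ K := K.2
  have hτ : 0 < τ := by positivity
  have hKτ : K * τ ≤ 1 / 2 := by
    rw [hτdef]; field_simp; linarith
  choose X hX0 hX using exists_solution_Icc hf hc hτ.le hKτ t₀ x₀
  -- By uniqueness the solutions on nested intervals agree, so the value at `t` may be read from any
  -- interval that contains it.
  have heq : ∀ {m n : ℕ} {t : ℝ}, t ∈ Icc (t₀ - m * τ) (t₀ + m * τ) →
      t ∈ Icc (t₀ - n * τ) (t₀ + n * τ) → X m t = X n t := by
    intro m n t hm hn
    wlog hmn : m ≤ n generalizing m n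
    · exact (this hn hm (le_of_not_ge hmn)).symm
    have hmn' : (m : ℝ) * τ ≤ n * τ := by gcongr
    have hs : Icc (t₀ - m * τ) (t₀ + m * τ) ⊆ Icc (t₀ - n * τ) (t₀ + n * τ) :=
      Icc_subset_Icc (by linarith) (by linarith)
    have hm0 : 0 ≤ m * τ := by positivity
    exact solution_unique (fun t _ => hf t) (t₀ := t₀) ⟨by linarith, by linarith⟩ (hX m)
      (fun s hs' => (hX n s (hs hs')).mono hs) (by rw [hX0, hX0]) hm
  have hex : ∀ t : ℝ, ∃ n : ℕ, t ∈ Ioo (t₀ - n * τ) (t₀ + n * τ) := by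
    intro t
    obtain ⟨n, hn⟩ := exists_nat_gt (|t - t₀| / τ)
    rw [div_lt_iff₀ hτ] at hn
    have := abs_lt.1 hn
    exact ⟨n, by linarith, by linarith⟩
  choose N hN using hex
  refine ⟨fun t => X (N t) t, by simp [hX0], fun t => ?_⟩
  have hnhds : Ioo (t₀ - N t * τ) (t₀ + N t * τ) ∈ 𝓝 t := isOpen_Ioo.mem_nhds (hN t)
  have h1 : HasDerivAt (X (N t)) (f t (X (N t) t)) t :=
    (hX (N t) t (Ioo_subset_Icc_self (hN t))).hasDerivAt
      (mem_of_superset hnhds Ioo_subset_Icc_self)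
  refine h1.congr_of_eventuallyEq ?_
  filter_upwards [hnhds] with s hs
  exact heq (Ioo_subset_Icc_self (hN s)) (Ioo_subset_Icc_self hs)

/-- Continuous dependence on parameters. -/
theorem continuous_solution_of_parameter {P : Type*} [TopologicalSpace P] {f : P → ℝ → F → F}
    {K : ℝ≥0} (hf : ∀ p t, LipschitzWith K (f p t))
    (hc : Continuous fun q : P × ℝ × F => f q.1 q.2.1 q.2.2) {X : P → ℝ → F}
    (hX : ∀ p t, HasDerivAt (X p) (f p t (X p t)) t) (h0 : Continuous fun p => X p 0) :
    Continuous fun q : P × ℝ => X q.1 q.2 := by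
  have hXc : ∀ p, Continuous (X p) := fun p =>
    continuous_iff_continuousAt.2 fun t => (hX p t).continuousAt
  rw [continuous_iff_continuousAt]
  rintro ⟨p₀, t₁⟩
  set T : ℝ := |t₁| + 1 with hT
  have hT0 : 0 < T := by positivity
  have key : ∀ δ > 0, ∀ᶠ p in 𝓝 p₀, ∀ t ∈ Icc (-T) T, dist (X p t) (X p₀ t) < δ := by
    intro δ hδ
    -- The curve `X p₀` solves the equation with parameter `p` up to an error `ε`; this choice makes
    -- the Grönwall bound `δ / 2`.
    set ε : ℝ := δ / (2 * (1 + (T - -T)) * Real.exp (K * (T - -T))) with hε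
    have hTT : 0 < T - -T := by linarith
    have hε0 : 0 < ε := by positivity
    have h1 : ∀ᶠ p in 𝓝 p₀, ∀ t ∈ Icc (-T) T, dist (f p t (X p₀ t)) (f p₀ t (X p₀ t)) < ε := by
      apply isCompact_Icc.eventually_forall_of_forall_eventually
      intro t _
      have hcont : Continuous fun q : P × ℝ => dist (f q.1 q.2 (X p₀ q.2)) (f p₀ q.2 (X p₀ q.2)) := by
        have a1 : Continuous fun q : P × ℝ => f q.1 q.2 (X p₀ q.2) :=
          hc.comp (continuous_fst.prodMk (continuous_snd.prodMk ((hXc p₀).comp continuous_snd)))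
        have a2 : Continuous fun q : P × ℝ => f p₀ q.2 (X p₀ q.2) :=
          hc.comp (continuous_const.prodMk (continuous_snd.prodMk ((hXc p₀).comp continuous_snd)))
        exact a1.dist a2
      exact hcont.continuousAt.eventually_lt continuousAt_const (by simpa using hε0)
    have h2 : ∀ᶠ p in 𝓝 p₀, dist (X p 0) (X p₀ 0) < ε :=
      h0.continuousAt.eventually (Metric.ball_mem_nhds _ hε0)
    filter_upwards [h1, h2] with p hp1 hp2 t ht
    have := dist_le_of_approx_solution (a := -T) (b := T) (t₀ := 0) (X := X p) (Y := X p₀)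
      (fun t _ => hf p t) ⟨by linarith, by linarith⟩
      (fun t _ => (hX p t).hasDerivWithinAt) (fun t _ => (hX p₀ t).hasDerivWithinAt) (ε := 0)
      (by simp) (fun t ht => by rw [dist_comm]; exact (hp1 t ht).le) ht
    refine this.trans_lt ?_
    calc (dist (X p 0) (X p₀ 0) + (0 + ε) * (T - -T)) * Real.exp (K * (T - -T))
        ≤ (ε + (0 + ε) * (T - -T)) * Real.exp (K * (T - -T)) := by gcongr
      _ = δ / 2 := by rw [hε]; field_simp; ring
      _ < δ := by linarith
  rw [Metric.continuousAt_iff']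
  intro δ hδ
  have h1 := (key (δ / 2) (by linarith)).prod_nhds
    (Ioo_mem_nhds (show -T < t₁ by linarith [neg_abs_le t₁])
      (show t₁ < T by linarith [le_abs_self t₁]))
  have h2 : ∀ᶠ q : P × ℝ in 𝓝 (p₀, t₁), dist (X p₀ q.2) (X p₀ t₁) < δ / 2 :=
    ((hXc p₀).comp continuous_snd).continuousAt.eventually (Metric.ball_mem_nhds _ (by linarith))
  filter_upwards [h1, h2] with q hq1 hq2
  have := hq1.1 q.2 ⟨hq1.2.1.le, hq1.2.2.le⟩
  linarith [dist_triangle (X q.1 q.2) (X p₀ q.2) (X p₀ t₁)]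

end ODE

/-! ### Differentiability from slope functions. -/

section Slope

variable {V W : Type*} [NormedAddCommGroup V] [NormedSpace ℝ V] [NormedAddCommGroup W]
  [NormedSpace ℝ W]

/-- Carathéodory's criterion: a map with a continuous slope function is differentiable. -/
theorem hasFDerivAt_of_slope {f : V → W} {S : V → V →L[ℝ] W} {x : V} (hS : ContinuousAt S x)
    (h : ∀ y, f y - f x = S y (y - x)) : HasFDerivAt f (S x) x := by
  rw [hasFDerivAt_iff_isLittleO, Asymptotics.isLittleO_iff]
  intro c hc
  filter_upwards [hS.eventually (Metric.ball_mem_nhds _ hc)] with y hy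
  rw [h, ← sub_apply]
  refine (ContinuousLinearMap.le_opNorm _ _).trans ?_
  gcongr
  rw [← dist_eq_norm]
  exact (Metric.mem_ball.1 hy).le

theorem contDiff_one_of_slope {f : V → W} {S : V → V → V →L[ℝ] W}
    (hS : Continuous fun p : V × V => S p.1 p.2) (h : ∀ x y, f y - f x = S x y (y - x)) :
    ContDiff ℝ 1 f :=
  contDiff_one_iff_hasFDerivAt.2 ⟨fun x => S x x, hS.comp (continuous_id.prodMk continuous_id),
    fun x => hasFDerivAt_of_slope
      (hS.comp (continuous_const.prodMk continuous_id)).continuousAt (h x)⟩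

theorem sub_eq_smul_integral {X X' : ℝ → V} [CompleteSpace V] (h : ∀ t, HasDerivAt X (X' t) t)
    (hc : Continuous X') (t t' : ℝ) :
    X t' - X t = (t' - t) • ∫ θ in (0 : ℝ)..1, X' (t + θ * (t' - t)) := by
  have := intervalIntegral.integral_unitInterval_deriv_eq_sub (𝕜 := ℝ) (f := X) (f' := X')
    (z₀ := t) (z₁ := t' - t) (hc.comp (by fun_prop)).continuousOn (fun s _ => h _)
  simpa using this.symm

end Slope

/-! ### The flow of a Lipschitz field and its inverse. -/

section Flow

open Filter Topology NNReal

variable {E : Type*} [NormedAddCommGroup E] [NormedSpace ℝ E]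

/-- The integral curve of the time-dependent field `v` that passes through `x` at time `s`. -/
noncomputable def integralCurve (v : ℝ → E → E) (s : ℝ) (x : E) : ℝ → E :=
  Classical.epsilon fun X : ℝ → E => X s = x ∧ ∀ t, HasDerivAt X (v t (X t)) t

/-- The position at time `t` of the particle that starts at `ξ` at time `0`. -/
noncomputable def flow (v : ℝ → E → E) (t : ℝ) (ξ : E) : E := integralCurve v 0 ξ t

/-- The position at time `0` of the particle that is at `x` at time `t`. -/
noncomputable def backFlow (v : ℝ → E → E) (t : ℝ) (x : E) : E := integralCurve v t x 0

/-- A jointly continuous time-dependent field, Lipschitz in space uniformly in time. -/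
structure LipschitzField (K : ℝ≥0) (v : ℝ → E → E) : Prop where
  lip : ∀ t, LipschitzWith K (v t)
  cont : Continuous fun p : ℝ × E => v p.1 p.2

namespace LipschitzField

variable [CompleteSpace E] {K : ℝ≥0} {v : ℝ → E → E} (hv : LipschitzField K v)

include hv

theorem integralCurve_spec (s : ℝ) (x : E) : integralCurve v s x s = x ∧
    ∀ t, HasDerivAt (integralCurve v s x) (v t (integralCurve v s x t)) t :=
  Classical.epsilon_spec (p := fun X : ℝ → E => X s = x ∧ ∀ t, HasDerivAt X (v t (X t)) t)
    (exists_solution_global hv.lip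
    (fun _ => hv.cont.comp (continuous_id.prodMk continuous_const)) s x)

theorem hasDerivAt_flow (ξ : E) (t : ℝ) :
    HasDerivAt (fun s => flow v s ξ) (v t (flow v t ξ)) t :=
  (hv.integralCurve_spec 0 ξ).2 t

theorem flow_zero (ξ : E) : flow v 0 ξ = ξ := (hv.integralCurve_spec 0 ξ).1

theorem backFlow_flow (t : ℝ) (ξ : E) : backFlow v t (flow v t ξ) = ξ := by
  have := solution_unique_global (t₀ := t) hv.lip (hv.integralCurve_spec t (flow v t ξ)).2
    (hv.integralCurve_spec 0 ξ).2 (hv.integralCurve_spec t (flow v t ξ)).1 0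
  rw [backFlow, this, (hv.integralCurve_spec 0 ξ).1]

theorem flow_backFlow (t : ℝ) (x : E) : flow v t (backFlow v t x) = x := by
  have := solution_unique_global (t₀ := 0) hv.lip (hv.integralCurve_spec 0 (backFlow v t x)).2
    (hv.integralCurve_spec t x).2 (hv.integralCurve_spec 0 (backFlow v t x)).1 t
  rw [flow, this, (hv.integralCurve_spec t x).1]

theorem continuous_flow : Continuous fun p : ℝ × E => flow v p.1 p.2 := by
  have := continuous_solution_of_parameter (P := E) (f := fun _ => v) (K := K)
    (X := fun ξ t => flow v t ξ) (fun _ => hv.lip) (hv.cont.comp continuous_snd)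
    (fun ξ t => hv.hasDerivAt_flow ξ t) (by simp only [hv.flow_zero]; exact continuous_id)
  exact this.comp continuous_swap

theorem continuous_velocity : Continuous fun p : ℝ × E => v p.1 (flow v p.1 p.2) :=
  hv.cont.comp (continuous_fst.prodMk hv.continuous_flow)

/-- Grönwall run from time `t` back to time `0`; this is the Lipschitz bound for the inverse flow.
-/
theorem dist_le_dist_flow (t : ℝ) (ξ η : E) :
    dist ξ η ≤ dist (flow v t ξ) (flow v t η) * Real.exp (K * |t|) := by
  have := dist_le_of_solution (a := min t 0) (b := max t 0) (t₀ := t) (t := 0)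
    (fun s _ => hv.lip s) ⟨by simp, by simp⟩
    (fun s _ => (hv.hasDerivAt_flow ξ s).hasDerivWithinAt)
    (fun s _ => (hv.hasDerivAt_flow η s).hasDerivWithinAt) ⟨by simp, by simp⟩
  simp only [hv.flow_zero, max_sub_min_eq_abs] at this
  simpa using this

/-- Both starting points are carried forward to the same time `t`, where the first lands on `x` and
the second is compared with `x₀` by the triangle inequality. -/
theorem dist_backFlow_le (t t₀ : ℝ) (x x₀ : E) :
    dist (backFlow v t x) (backFlow v t₀ x₀) ≤
      (dist x x₀ + dist (flow v t (backFlow v t₀ x₀)) (flow v t₀ (backFlow v t₀ x₀)))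
        * Real.exp (K * |t|) := by
  refine (hv.dist_le_dist_flow t _ _).trans ?_
  rw [hv.flow_backFlow, hv.flow_backFlow]
  gcongr
  rw [dist_comm (flow v t _)]
  exact dist_triangle _ _ _

theorem dist_flow_time_le {M : ℝ} (hM : ∀ t x, ‖v t x‖ ≤ M) (t t₀ : ℝ) (ξ : E) :
    dist (flow v t ξ) (flow v t₀ ξ) ≤ M * |t - t₀| := by
  rw [dist_eq_norm, ← Real.norm_eq_abs]
  exact convex_univ.norm_image_sub_le_of_norm_hasDerivWithin_le
    (f := fun s => flow v s ξ) (fun s _ => (hv.hasDerivAt_flow ξ s).hasDerivWithinAt)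
    (fun s _ => hM _ _) (mem_univ _) (mem_univ _)

/-- The modulus depends on the field only through `K` and `M`; this yields equicontinuity of the
approximate flows. -/
theorem dist_backFlow_le_of_bounded {M : ℝ} (hM : ∀ t x, ‖v t x‖ ≤ M) (t t₀ : ℝ) (x x₀ : E) :
    dist (backFlow v t x) (backFlow v t₀ x₀) ≤
      (dist x x₀ + M * |t - t₀|) * Real.exp (K * |t|) := by
  refine (hv.dist_backFlow_le t t₀ x x₀).trans ?_
  gcongr
  exact hv.dist_flow_time_le hM ..

theorem continuous_backFlow : Continuous fun p : ℝ × E => backFlow v p.1 p.2 := by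
  rw [continuous_iff_continuousAt]
  rintro ⟨t₀, x₀⟩
  refine tendsto_iff_dist_tendsto_zero.2 (squeeze_zero (fun _ => dist_nonneg)
    (fun p => hv.dist_backFlow_le p.1 t₀ p.2 x₀) ?_)
  have hc : Continuous fun p : ℝ × E =>
      (dist p.2 x₀ + dist (flow v p.1 (backFlow v t₀ x₀)) (flow v t₀ (backFlow v t₀ x₀)))
        * Real.exp (K * |p.1|) := by
    have := hv.continuous_flow.comp
      (continuous_fst.prodMk continuous_const : Continuous fun p : ℝ × E => (p.1, backFlow v t₀ x₀))
    exact ((continuous_snd.dist continuous_const).add (this.dist continuous_const)).mul (by fun_prop)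
  simpa using hc.tendsto (t₀, x₀)

theorem backFlow_eq {X : ℝ → E} {t : ℝ} (ht : 0 ≤ t)
    (hX : ∀ s ∈ Icc 0 t, HasDerivWithinAt X (v s (X s)) (Icc 0 t) s) :
    backFlow v t (X t) = X 0 :=
  solution_unique (fun s _ => hv.lip s) (right_mem_Icc.2 ht)
    (fun s _ => ((hv.integralCurve_spec t (X t)).2 s).hasDerivWithinAt) hX
    (hv.integralCurve_spec t (X t)).1 (left_mem_Icc.2 ht)

end LipschitzField

/-- A continuous slope function for the field `v`. -/
structure IsFieldSlope (K : ℝ≥0) (v : ℝ → E → E) (S : ℝ → E → E → E →L[ℝ] E) : Prop where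
  cont : Continuous fun q : ℝ × E × E => S q.1 q.2.1 q.2.2
  bound : ∀ t x y, ‖S t x y‖₊ ≤ K
  eq : ∀ t x y, v t y - v t x = S t x y (y - x)

theorem IsFieldSlope.lipschitzWith {K : ℝ≥0} {v : ℝ → E → E} {S : ℝ → E → E → E →L[ℝ] E}
    (hS : IsFieldSlope K v S) (t : ℝ) : LipschitzWith K (v t) := by
  refine LipschitzWith.of_dist_le_mul fun x y => ?_
  rw [dist_comm, dist_comm x, dist_eq_norm, dist_eq_norm, hS.eq]
  refine (ContinuousLinearMap.le_opNorm _ _).trans ?_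
  gcongr
  exact hS.bound ..

namespace LipschitzField

variable [CompleteSpace E] {K : ℝ≥0} {v : ℝ → E → E} {S : ℝ → E → E → E →L[ℝ] E}

/-- The slope in space of the flow, together with its inverse. -/
theorem exists_flow_slope (hv : LipschitzField K v) (hS : IsFieldSlope K v S) :
    ∃ J I : (E × E) → ℝ → E →L[ℝ] E, (Continuous fun q : (E × E) × ℝ => J q.1 q.2) ∧
      (Continuous fun q : (E × E) × ℝ => I q.1 q.2) ∧
      (∀ p t, flow v t p.2 - flow v t p.1 = J p t (p.2 - p.1)) ∧
      (∀ p t, I p t * J p t = 1) ∧ (∀ p t, J p t * I p t = 1) := by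
  -- The slope of `v` between two trajectories. Their difference solves the linear equation `y' = B
  -- y` exactly, so its propagator `J` is the slope of the flow; `I` solves the adjoint equation `I'
  -- = -I B`.
  let B : (E × E) → ℝ → E →L[ℝ] E := fun p t => S t (flow v t p.1) (flow v t p.2)
  have hB : Continuous fun q : (E × E) × ℝ => B q.1 q.2 := by
    have h1 : Continuous fun q : (E × E) × ℝ => flow v q.2 q.1.1 :=
      hv.continuous_flow.comp (continuous_snd.prodMk (continuous_fst.comp continuous_fst))
    have h2 : Continuous fun q : (E × E) × ℝ => flow v q.2 q.1.2 :=
      hv.continuous_flow.comp (continuous_snd.prodMk (continuous_snd.comp continuous_fst))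
    exact hS.cont.comp (continuous_snd.prodMk (h1.prodMk h2))
  have hBK : ∀ p t, ‖B p t‖ ≤ K := fun p t => hS.bound ..
  have hL : ∀ p t, LipschitzWith K fun A : E →L[ℝ] E => B p t * A := by
    refine fun p t => LipschitzWith.of_dist_le_mul fun A A' => ?_
    rw [dist_eq_norm, dist_eq_norm, ← mul_sub]
    exact (norm_mul_le _ _).trans (by gcongr; exact hBK p t)
  have hR : ∀ p t, LipschitzWith K fun A : E →L[ℝ] E => -(A * B p t) := by
    refine fun p t => LipschitzWith.of_dist_le_mul fun A A' => ?_
    rw [dist_neg_neg, dist_eq_norm, dist_eq_norm, ← sub_mul, mul_comm]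
    exact (norm_mul_le _ _).trans (by gcongr; exact hBK p t)
  have hBt : ∀ p, Continuous (B p) := fun p => hB.comp (continuous_const.prodMk continuous_id)
  choose J hJ0 hJ using fun p => exists_solution_global (hL p)
    (fun A => (hBt p).mul continuous_const) 0 1
  choose I hI0 hI using fun p => exists_solution_global (hR p)
    (fun A => (continuous_const.mul (hBt p)).neg) 0 1
  have hq : Continuous fun q : (E × E) × ℝ × (E →L[ℝ] E) => B q.1 q.2.1 :=
    hB.comp (continuous_fst.prodMk (continuous_fst.comp continuous_snd))
  have hq' : Continuous fun q : (E × E) × ℝ × (E →L[ℝ] E) => q.2.2 :=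
    continuous_snd.comp continuous_snd
  refine ⟨J, I, continuous_solution_of_parameter hL (hq.mul hq') hJ
      (by simp only [hJ0]; exact continuous_const),
    continuous_solution_of_parameter hR (hq'.mul hq).neg hI
      (by simp only [hI0]; exact continuous_const), ?_, ?_, ?_⟩
  · intro p t
    have hLip : ∀ t, LipschitzWith K fun y : E => B p t y := fun t =>
      ((B p t).lipschitz).weaken (hS.bound ..)
    refine solution_unique_global (f := fun t y => B p t y)
      (X := fun t => flow v t p.2 - flow v t p.1) (Y := fun t => J p t (p.2 - p.1)) (t₀ := 0)
      hLip ?_ ?_ ?_ t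
    · intro t
      have := (hv.hasDerivAt_flow p.2 t).sub (hv.hasDerivAt_flow p.1 t)
      rw [hS.eq] at this
      exact this
    · intro t
      exact (hJ p t).clm_apply (hasDerivAt_const t (p.2 - p.1)) |>.congr_deriv (by simp)
    · simp [hv.flow_zero, hJ0]
  · intro p t
    have h1 : ∀ t, HasDerivAt (fun t => I p t * J p t) 0 t := fun t =>
      ((hI p t).mul (hJ p t)).congr_deriv (by noncomm_ring)
    have := is_const_of_deriv_eq_zero (fun t => (h1 t).differentiableAt)
      (fun t => (h1 t).deriv) t 0
    simpa [hI0, hJ0] using this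
  · intro p t
    -- Here the derivative is `B(JI) - (JI)B`, not visibly zero; but the constant `1` solves the
    -- same linear equation with the same initial value.
    have hLip : ∀ t, LipschitzWith (K + K) fun A : E →L[ℝ] E => B p t * A + -(A * B p t) :=
      fun t => (hL p t).add (hR p t)
    refine solution_unique_global (f := fun t A => B p t * A + -(A * B p t))
      (X := fun t => J p t * I p t) (Y := fun _ => 1) (t₀ := 0) hLip ?_ ?_ ?_ t
    · exact fun t => ((hJ p t).mul (hI p t)).congr_deriv (by noncomm_ring)
    · exact fun t => (hasDerivAt_const t (1 : E →L[ℝ] E)).congr_deriv (by simp)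
    · simp [hI0, hJ0]

/-- The mean velocity of the particle that starts at `ξ`, between the times `t` and `t'`. -/
theorem exists_time_slope (hv : LipschitzField K v) :
    ∃ U : ℝ → ℝ → E → E, (Continuous fun q : ℝ × ℝ × E => U q.1 q.2.1 q.2.2) ∧
      ∀ t t' ξ, flow v t' ξ - flow v t ξ = (t' - t) • U t t' ξ := by
  refine ⟨fun t t' ξ => ∫ θ in (0 : ℝ)..1,
    v (t + θ * (t' - t)) (flow v (t + θ * (t' - t)) ξ), ?_, fun t t' ξ =>
    sub_eq_smul_integral (hv.hasDerivAt_flow ξ)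
      (hv.continuous_velocity.comp (continuous_id.prodMk continuous_const)) t t'⟩
  refine intervalIntegral.continuous_parametric_intervalIntegral_of_continuous' ?_ 0 1
  exact hv.continuous_velocity.comp (f := fun q : (ℝ × ℝ × E) × ℝ =>
    (q.1.1 + q.2 * (q.1.2.1 - q.1.1), q.1.2.2)) (by fun_prop)

/-- The increment splits into a change of time at fixed `ξ`, with slope `U`, and a change of
starting point at the fixed time `t'`, with slope `J`. -/
theorem contDiff_flow (hv : LipschitzField K v) (hS : IsFieldSlope K v S) :
    ContDiff ℝ 1 fun p : ℝ × E => flow v p.1 p.2 := by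
  obtain ⟨J, I, hJ, -, hJe, -, -⟩ := hv.exists_flow_slope hS
  obtain ⟨U, hU, hUe⟩ := hv.exists_time_slope
  refine contDiff_one_of_slope (S := fun p q =>
    (ContinuousLinearMap.fst ℝ ℝ E).smulRight (U p.1 q.1 p.2) +
      (J (p.2, q.2) q.1).comp (ContinuousLinearMap.snd ℝ ℝ E)) ?_ ?_
  · have h1 : Continuous fun r : (ℝ × E) × ℝ × E => U r.1.1 r.2.1 r.1.2 :=
      hU.comp (f := fun r : (ℝ × E) × ℝ × E => (r.1.1, r.2.1, r.1.2)) (by fun_prop)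
    have h2 : Continuous fun r : (ℝ × E) × ℝ × E => J (r.1.2, r.2.2) r.2.1 :=
      hJ.comp (f := fun r : (ℝ × E) × ℝ × E => ((r.1.2, r.2.2), r.2.1)) (by fun_prop)
    exact (((ContinuousLinearMap.smulRightL ℝ (ℝ × E) E
      (ContinuousLinearMap.fst ℝ ℝ E)).continuous).comp h1).add (h2.clm_comp continuous_const)
  · rintro ⟨t, ξ⟩ ⟨t', ξ'⟩
    have h1 := hUe t t' ξ
    have h2 := hJe (ξ, ξ') t'
    simp only [add_apply, ContinuousLinearMap.smulRight_apply,
      ContinuousLinearMap.coe_fst', ContinuousLinearMap.comp_apply, ContinuousLinearMap.coe_snd',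
      Prod.fst_sub, Prod.snd_sub]
    rw [← h1, ← h2]
    abel

/-- If `ξ, ξ'` are the starting points, then `J (ξ' - ξ) = (x' - x) - (t' - t) U`. Applying `I`
gives an explicit continuous slope, without the inverse function theorem. -/
theorem contDiff_backFlow (hv : LipschitzField K v) (hS : IsFieldSlope K v S) :
    ContDiff ℝ 1 fun p : ℝ × E => backFlow v p.1 p.2 := by
  obtain ⟨J, I, -, hI, hJe, hIJ, -⟩ := hv.exists_flow_slope hS
  obtain ⟨U, hU, hUe⟩ := hv.exists_time_slope
  refine contDiff_one_of_slope (S := fun p q =>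
    (I (backFlow v p.1 p.2, backFlow v q.1 q.2) q.1).comp
      (ContinuousLinearMap.snd ℝ ℝ E -
        (ContinuousLinearMap.fst ℝ ℝ E).smulRight (U p.1 q.1 (backFlow v p.1 p.2)))) ?_ ?_
  · have hb := hv.continuous_backFlow
    have hb1 : Continuous fun r : (ℝ × E) × ℝ × E => backFlow v r.1.1 r.1.2 := hb.comp continuous_fst
    have hb2 : Continuous fun r : (ℝ × E) × ℝ × E => backFlow v r.2.1 r.2.2 := hb.comp continuous_snd
    have h1 : Continuous fun r : (ℝ × E) × ℝ × E => U r.1.1 r.2.1 (backFlow v r.1.1 r.1.2) :=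
      hU.comp ((continuous_fst.comp continuous_fst).prodMk
        ((continuous_fst.comp continuous_snd).prodMk hb1))
    have h2 : Continuous fun r : (ℝ × E) × ℝ × E =>
        I (backFlow v r.1.1 r.1.2, backFlow v r.2.1 r.2.2) r.2.1 :=
      hI.comp ((hb1.prodMk hb2).prodMk (continuous_fst.comp continuous_snd))
    exact h2.clm_comp (continuous_const.sub (((ContinuousLinearMap.smulRightL ℝ (ℝ × E) E
      (ContinuousLinearMap.fst ℝ ℝ E)).continuous).comp h1))
  · rintro ⟨t, x⟩ ⟨t', x'⟩
    have h1 := hUe t t' (backFlow v t x)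
    have h2 := hJe (backFlow v t x, backFlow v t' x') t'
    have h3 : ∀ y, I (backFlow v t x, backFlow v t' x') t'
        (J (backFlow v t x, backFlow v t' x') t' y) = y := fun y =>
      DFunLike.congr_fun (hIJ (backFlow v t x, backFlow v t' x') t') y
    simp only [ContinuousLinearMap.comp_apply, sub_apply,
      ContinuousLinearMap.smulRight_apply,
      ContinuousLinearMap.coe_fst', ContinuousLinearMap.coe_snd', Prod.fst_sub, Prod.snd_sub]
    rw [← h1, hv.flow_backFlow]
    simp only [hv.flow_backFlow] at h2
    rw [← h3 (backFlow v t' x' - backFlow v t x), ← h2]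
    congr 1
    abel

theorem det_fderiv_flow_ne_zero (hv : LipschitzField K v) (hS : IsFieldSlope K v S)
    (t : ℝ) (ξ : E) : (fderiv ℝ (flow v t) ξ).det ≠ 0 := by
  obtain ⟨J, I, hJ, -, hJe, hIJ, -⟩ := hv.exists_flow_slope hS
  have hd : HasFDerivAt (flow v t) (J (ξ, ξ) t) ξ :=
    hasFDerivAt_of_slope (S := fun η => J (ξ, η) t)
      (hJ.comp (f := fun η : E => ((ξ, η), t)) (by fun_prop)).continuousAt
      (fun η => hJe (ξ, η) t)
  rw [hd.fderiv]
  have h : LinearMap.det ((I (ξ, ξ) t : E →L[ℝ] E) : E →ₗ[ℝ] E) *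
      LinearMap.det ((J (ξ, ξ) t : E →L[ℝ] E) : E →ₗ[ℝ] E) = 1 := by
    rw [← map_mul]
    have : ((I (ξ, ξ) t : E →L[ℝ] E) : E →ₗ[ℝ] E) * ((J (ξ, ξ) t : E →L[ℝ] E) : E →ₗ[ℝ] E) = 1 := by
      ext y
      exact DFunLike.congr_fun (hIJ (ξ, ξ) t) y
    rw [this, map_one]
  exact right_ne_zero_of_mul_eq_one h

end LipschitzField

end Flow

/-! ### Convolution of a `W^{1,1}` kernel with a bounded continuous field. -/

section Convolution

open Filter Topology NNReal

/-- A bounded continuous map is a pointwise limit of uniformly bounded test functions. -/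
theorem exists_testFunction_seq {E F : Type*} [NormedAddCommGroup E] [NormedSpace ℝ E]
    [FiniteDimensional ℝ E] [NormedAddCommGroup F] [NormedSpace ℝ F] {w : E → F}
    (hw : Continuous w) {M : ℝ} (hM : ∀ x, ‖w x‖ ≤ M) :
    ∃ W : ℕ → E → F, (∀ k, ContDiff ℝ ∞ (W k)) ∧ (∀ k, HasCompactSupport (W k)) ∧
      (∀ k x, ‖W k x‖ ≤ M + 1) ∧ ∀ x, Tendsto (fun k => W k x) atTop (𝓝 (w x)) := by
  let χ : ℕ → ContDiffBump (0 : E) := fun k => ⟨k + 1, k + 2, by positivity, by linarith⟩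
  have hχ : ∀ k, Continuous fun x => χ k x • w x := fun k => (χ k).continuous.smul hw
  -- The cut-off field is approximated within `1 / (k + 1) ≤ 1`, whence the bound `M + 1`, by smooth
  -- maps whose support is no larger, hence compact.
  have happ := fun k : ℕ => (hχ k).exists_contDiff_approx (ε := fun _ => 1 / ((k : ℝ) + 1)) ⊤
    continuous_const (fun _ => by positivity)
  choose W hW1 hW2 hW3 using happ
  refine ⟨W, hW1, fun k => ?_, fun k x => ?_, fun x => ?_⟩
  · refine (χ k).hasCompactSupport.mono ((hW3 k).trans ?_)
    exact Function.support_smul_subset_left _ _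
  · have h1 : ‖χ k x • w x‖ ≤ M := by
      rw [norm_smul, Real.norm_of_nonneg (χ k).nonneg]
      exact (mul_le_of_le_one_left (norm_nonneg _) (χ k).le_one).trans (hM x)
    have h2 := hW2 k x
    rw [dist_eq_norm] at h2
    have h3 : 1 / ((k : ℝ) + 1) ≤ 1 := by
      rw [div_le_one (by positivity)]; linarith [(Nat.cast_nonneg k : (0 : ℝ) ≤ k)]
    linarith [norm_le_norm_add_norm_sub' (W k x) (χ k x • w x)]
  · rw [tendsto_iff_dist_tendsto_zero]
    refine squeeze_zero' (Eventually.of_forall fun _ => dist_nonneg) ?_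
      tendsto_one_div_add_atTop_nhds_zero_nat
    obtain ⟨N, hN⟩ := exists_nat_gt ‖x‖
    filter_upwards [eventually_ge_atTop N] with k hk
    have hkN : (N : ℝ) ≤ k := by exact_mod_cast hk
    have : χ k x = 1 := (χ k).one_of_mem_closedBall (by
      rw [mem_closedBall_zero_iff]; change ‖x‖ ≤ (k : ℝ) + 1; linarith)
    have h2 := hW2 k x
    rw [this, one_smul] at h2
    exact h2.le

variable {n : ℕ} {h g : RSpace n → ℝ} {w : RSpace n → RSpace n} {M : ℝ}

theorem filtered_apply (h : RSpace n → ℝ) (w : RSpace n → RSpace n) (x : RSpace n) :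
    filtered h w x = ∫ y, h y • w (x - y) := convolution_lsmul

theorem norm_filtered_le (hh : Integrable h) (hM : ∀ x, ‖w x‖ ≤ M) (x : RSpace n) :
    ‖filtered h w x‖ ≤ (∫ y, ‖h y‖) * M := by
  rw [filtered_apply, ← integral_mul_const]
  refine norm_integral_le_of_norm_le (hh.norm.mul_const M) (Eventually.of_forall fun y => ?_)
  rw [norm_smul]
  gcongr
  exact hM _

theorem integrable_filtered (hh : Integrable h) (hw : Continuous w) (hM : ∀ x, ‖w x‖ ≤ M)
    (x : RSpace n) : Integrable fun y => h y • w (x - y) := by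
  refine (hh.norm.mul_const M).mono' (hh.aestronglyMeasurable.smul
    (hw.comp (by fun_prop)).aestronglyMeasurable) (Eventually.of_forall fun y => ?_)
  rw [norm_smul]
  gcongr
  exact hM _

theorem continuous_filtered {P : Type*} [TopologicalSpace P] [FirstCountableTopology P]
    {w : P → RSpace n → RSpace n} (hh : Integrable h)
    (hw : Continuous fun q : P × RSpace n => w q.1 q.2) (hM : ∀ p x, ‖w p x‖ ≤ M) :
    Continuous fun q : P × RSpace n => filtered h (w q.1) q.2 := by
  simp only [filtered_apply]
  refine continuous_of_dominated (bound := fun y => ‖h y‖ * M) (fun q => ?_) (fun q => ?_)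
    (hh.norm.mul_const M) (Eventually.of_forall fun y => ?_)
  · exact hh.aestronglyMeasurable.smul
      (hw.comp (f := fun y => (q.1, q.2 - y)) (by fun_prop)).aestronglyMeasurable
  · refine Eventually.of_forall fun y => ?_
    rw [norm_smul]
    gcongr
    exact hM _ _
  · exact (hw.comp (f := fun q : P × RSpace n => (q.1, q.2 - y)) (by fun_prop)).const_smul (h y)

theorem continuous_filtered_apply (hh : Integrable h) (hw : Continuous w) (hM : ∀ x, ‖w x‖ ≤ M) :
    Continuous (filtered h w) :=
  (continuous_filtered (P := Unit) (w := fun _ => w) hh (hw.comp continuous_snd)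
    (fun _ => hM)).comp (continuous_const.prodMk continuous_id : Continuous fun x => ((), x))

theorem tendsto_filtered {W : ℕ → RSpace n → RSpace n} (hh : Integrable h)
    (hW : ∀ k, Continuous (W k)) (hM : ∀ k x, ‖W k x‖ ≤ M)
    (hlim : ∀ x, Tendsto (fun k => W k x) atTop (𝓝 (w x))) (x : RSpace n) :
    Tendsto (fun k => filtered h (W k) x) atTop (𝓝 (filtered h w x)) := by
  simp only [filtered_apply]
  refine tendsto_integral_of_dominated_convergence (fun y => ‖h y‖ * M)
    (fun k => (integrable_filtered hh (hW k) (hM k) x).aestronglyMeasurable)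
    (hh.norm.mul_const M) (fun k => Eventually.of_forall fun y => ?_)
    (Eventually.of_forall fun y => (hlim _).const_smul _)
  rw [norm_smul]
  gcongr
  exact hM _ _

/-- The total derivative built from the convolutions of `w` with the partial derivatives `h`. -/
noncomputable def gradFiltered (h : Fin n → RSpace n → ℝ) (w : RSpace n → RSpace n)
    (x : RSpace n) : RSpace n →L[ℝ] RSpace n :=
  ∑ i, (EuclideanSpace.proj i : RSpace n →L[ℝ] ℝ).smulRight (filtered (h i) w x)

theorem gradFiltered_apply (h : Fin n → RSpace n → ℝ) (w : RSpace n → RSpace n)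
    (x e : RSpace n) : gradFiltered h w x e = ∑ i, e i • filtered (h i) w x := by
  simp [gradFiltered, sum_apply]

theorem gradFiltered_basisVec (h : Fin n → RSpace n → ℝ) (w : RSpace n → RSpace n)
    (x : RSpace n) (i : Fin n) : gradFiltered h w x (basisVec i) = filtered (h i) w x := by
  rw [gradFiltered_apply, Finset.sum_eq_single i]
  · simp [basisVec]
  · intro j _ hj; simp [basisVec, hj]
  · simp

theorem sum_smul_basisVec (e : RSpace n) : ∑ i, e i • basisVec i = e := by
  ext j
  simp [basisVec, Pi.single_apply]

/-- The weak derivative is tested, one component at a time, against `y ↦ ψ (x - y)`; the sign from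
the reflection cancels the one from integration by parts. -/
theorem IsWeakPartial.integral_fderiv_smul {i : Fin n} (hg : Integrable g)
    (hh : IsWeakPartial g i h) {ψ : RSpace n → RSpace n} (hψ : ContDiff ℝ ∞ ψ)
    (hc : HasCompactSupport ψ) (x : RSpace n) :
    ∫ y, g y • fderiv ℝ ψ (x - y) (basisVec i) = filtered h ψ x := by
  have hψd : Differentiable ℝ ψ := hψ.differentiable (by simp)
  obtain ⟨C, hC⟩ := hc.exists_bound_of_continuous hψ.continuous
  have hψ' : Continuous fun y => fderiv ℝ ψ y (basisVec i) :=
    (hψ.continuous_fderiv (by simp)).clm_apply continuous_const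
  obtain ⟨C', hC'⟩ := (hc.fderiv_apply (𝕜 := ℝ) (v := basisVec i)).exists_bound_of_continuous hψ'
  have hi1 := integrable_filtered hg hψ' hC' x
  have hi2 := integrable_filtered hh.1 hψ.continuous hC x
  rw [filtered_apply]
  ext j
  rw [eval_integral_piLp hi1.eval_piLp, eval_integral_piLp hi2.eval_piLp]
  have hs : ContDiff ℝ ∞ fun y => ψ (x - y) j :=
    (contDiff_euclidean.1 (hψ.comp (contDiff_const.sub contDiff_id))) j
  have hsc : HasCompactSupport fun y => ψ (x - y) j := by
    have h1 : HasCompactSupport fun y => ψ (x - y) :=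
      hc.comp_homeomorph (Homeomorph.subLeft x)
    exact h1.comp_left (g := fun z : RSpace n => z j) rfl
  have hd : ∀ y, fderiv ℝ (fun y => ψ (x - y) j) y (basisVec i) =
      -(fderiv ℝ ψ (x - y) (basisVec i) j) := by
    intro y
    have h1 : HasFDerivAt (fun y => x - y) (-ContinuousLinearMap.id ℝ (RSpace n)) y :=
      (hasFDerivAt_id y).const_sub x
    have h2 := ((EuclideanSpace.proj j : RSpace n →L[ℝ] ℝ).hasFDerivAt).comp y
      ((hψd (x - y)).hasFDerivAt.comp y h1)
    have h3 : fderiv ℝ (fun y => ψ (x - y) j) y = _ := h2.fderiv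
    rw [h3]
    simp
  have := hh.2 _ hs hsc
  simp only [hd, mul_neg, integral_neg, neg_inj] at this
  simpa using this

theorem hasFDerivAt_filtered_testFunction {h : Fin n → RSpace n → ℝ} (hg : Integrable g)
    (hh : ∀ i, IsWeakPartial g i (h i)) {ψ : RSpace n → RSpace n} (hψ : ContDiff ℝ ∞ ψ)
    (hc : HasCompactSupport ψ) (x : RSpace n) :
    HasFDerivAt (filtered g ψ) (gradFiltered h ψ x) x := by
  have hd := hc.hasFDerivAt_convolution_right (ContinuousLinearMap.lsmul ℝ ℝ)
    hg.locallyIntegrable (hψ.of_le (by simp)) x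
  have hψ' : Continuous (fderiv ℝ ψ) := hψ.continuous_fderiv (by simp)
  obtain ⟨C, hC⟩ := (hc.fderiv (𝕜 := ℝ)).exists_bound_of_continuous hψ'
  refine hd.congr_fderiv ?_
  ext1 e
  rw [convolution_precompR_apply _ hg.locallyIntegrable (hc.fderiv (𝕜 := ℝ)) hψ',
    convolution_lsmul, gradFiltered_apply]
  have hi : ∀ i, Integrable fun y => g y • fderiv ℝ ψ (x - y) (basisVec i) := fun i =>
    integrable_filtered (w := fun z => fderiv ℝ ψ z (basisVec i)) (M := C * ‖basisVec (n := n) i‖) hg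
      (hψ'.clm_apply continuous_const) (fun z => (ContinuousLinearMap.le_opNorm _ _).trans
      (by gcongr; exact hC z)) x
  calc ∫ y, g y • fderiv ℝ ψ (x - y) e
      = ∫ y, ∑ i, e i • (g y • fderiv ℝ ψ (x - y) (basisVec i)) := by
        refine integral_congr_ae (Eventually.of_forall fun y => ?_)
        simp only
        conv_lhs => rw [← sum_smul_basisVec e]
        simp only [map_sum, map_smul, Finset.smul_sum]
        exact Finset.sum_congr rfl fun i _ => smul_comm _ _ _
    _ = ∑ i, e i • filtered (h i) ψ x := by
        have hi' : ∀ i, Integrable fun y => e i • (g y • fderiv ℝ ψ (x - y) (basisVec i)) :=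
          fun i => (hi i).smul (e i)
        rw [integral_finsetSum _ fun i _ => hi' i]
        refine Finset.sum_congr rfl fun i _ => ?_
        rw [integral_smul, (hh i).integral_fderiv_smul hg hψ hc]

theorem norm_gradFiltered_le {h : Fin n → RSpace n → ℝ} (hh : ∀ i, Integrable (h i))
    (hM : ∀ x, ‖w x‖ ≤ M) (x : RSpace n) :
    ‖gradFiltered h w x‖ ≤ (∑ i, ∫ y, ‖h i y‖) * M := by
  rw [gradFiltered, Finset.sum_mul]
  refine (norm_sum_le _ _).trans (Finset.sum_le_sum fun i _ => ?_)
  rw [ContinuousLinearMap.norm_smulRight_apply]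
  have h1 : ‖(EuclideanSpace.proj i : RSpace n →L[ℝ] ℝ)‖ ≤ 1 :=
    ContinuousLinearMap.opNorm_le_bound _ zero_le_one fun y => by
      simpa using PiLp.norm_apply_le y i
  exact (mul_le_of_le_one_left (norm_nonneg _) h1).trans (norm_filtered_le (hh i) hM x)

theorem continuous_gradFiltered {P : Type*} [TopologicalSpace P] [FirstCountableTopology P]
    {h : Fin n → RSpace n → ℝ} {w : P → RSpace n → RSpace n} (hh : ∀ i, Integrable (h i))
    (hw : Continuous fun q : P × RSpace n => w q.1 q.2) (hM : ∀ p x, ‖w p x‖ ≤ M) :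
    Continuous fun q : P × RSpace n => gradFiltered h (w q.1) q.2 := by
  refine continuous_finsetSum _ fun i _ => ?_
  exact ((ContinuousLinearMap.smulRightL ℝ (RSpace n) (RSpace n)
      (EuclideanSpace.proj i)).continuous).comp (continuous_filtered (hh i) hw hM)

theorem continuous_gradFiltered_apply {h : Fin n → RSpace n → ℝ} (hh : ∀ i, Integrable (h i))
    (hw : Continuous w) (hM : ∀ x, ‖w x‖ ≤ M) : Continuous (gradFiltered h w) := by
  refine continuous_finsetSum _ fun i _ => ?_
  exact ((ContinuousLinearMap.smulRightL ℝ (RSpace n) (RSpace n)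
      (EuclideanSpace.proj i)).continuous).comp (continuous_filtered_apply (hh i) hw hM)

/-- For test functions this is the fundamental theorem of calculus on a segment. Both sides involve
only values of `w`, not its derivatives, so dominated convergence extends it to `w` merely bounded
and continuous. -/
theorem filtered_sub_eq {h : Fin n → RSpace n → ℝ} (hg : Integrable g)
    (hh : ∀ i, IsWeakPartial g i (h i)) (hw : Continuous w) (hM : ∀ x, ‖w x‖ ≤ M)
    (x y : RSpace n) : filtered g w y - filtered g w x =
      (∫ θ in (0 : ℝ)..1, gradFiltered h w (x + θ • (y - x))) (y - x) := by
  have hline : Continuous fun θ : ℝ => x + θ • (y - x) := by fun_prop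
  obtain ⟨W, hW1, hW2, hW3, hW4⟩ := exists_testFunction_seq hw hM
  have hgc : ∀ k, Continuous fun θ : ℝ => gradFiltered h (W k) (x + θ • (y - x)) (y - x) :=
    fun k => ((continuous_gradFiltered_apply (fun i => (hh i).1) (hW1 k).continuous
      (hW3 k)).comp hline).clm_apply continuous_const
  have hsmooth : ∀ k, filtered g (W k) y - filtered g (W k) x =
      ∫ θ in (0 : ℝ)..1, gradFiltered h (W k) (x + θ • (y - x)) (y - x) := by
    intro k
    have hder : ∀ θ : ℝ, HasDerivAt (fun θ : ℝ => filtered g (W k) (x + θ • (y - x)))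
        (gradFiltered h (W k) (x + θ • (y - x)) (y - x)) θ := by
      intro θ
      have h1 : HasDerivAt (fun θ : ℝ => x + θ • (y - x)) (y - x) θ := by
        simpa using ((hasDerivAt_id θ).smul_const (y - x)).const_add x
      exact (hasFDerivAt_filtered_testFunction hg hh (hW1 k) (hW2 k) _).comp_hasDerivAt θ h1
    rw [intervalIntegral.integral_eq_sub_of_hasDerivAt (fun θ _ => hder θ)
      ((hgc k).intervalIntegrable _ _)]
    simp
  have hlim1 : Tendsto (fun k => filtered g (W k) y - filtered g (W k) x) atTop
      (𝓝 (filtered g w y - filtered g w x)) :=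
    (tendsto_filtered hg (fun k => (hW1 k).continuous) hW3 hW4 y).sub
      (tendsto_filtered hg (fun k => (hW1 k).continuous) hW3 hW4 x)
  have hlim2 : Tendsto (fun k => ∫ θ in (0 : ℝ)..1,
      gradFiltered h (W k) (x + θ • (y - x)) (y - x)) atTop
      (𝓝 (∫ θ in (0 : ℝ)..1, gradFiltered h w (x + θ • (y - x)) (y - x))) := by
    refine intervalIntegral.tendsto_integral_filter_of_dominated_convergence
      (fun _ => (∑ i, ∫ y, ‖h i y‖) * (M + 1) * ‖y - x‖)
      (Eventually.of_forall fun k => (hgc k).aestronglyMeasurable)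
      (Eventually.of_forall fun k => Eventually.of_forall fun θ _ => ?_)
      intervalIntegrable_const (Eventually.of_forall fun θ _ => ?_)
    · exact (ContinuousLinearMap.le_opNorm _ _).trans
        (by gcongr; exact norm_gradFiltered_le (fun i => (hh i).1) (hW3 k) _)
    · simp only [gradFiltered_apply]
      exact tendsto_finsetSum _ fun i _ =>
        (tendsto_filtered (hh i).1 (fun k => (hW1 k).continuous) hW3 hW4 _).const_smul _
  simp only [hsmooth] at hlim1
  rw [tendsto_nhds_unique hlim1 hlim2, ContinuousLinearMap.intervalIntegral_apply]
  exact ((continuous_gradFiltered_apply (fun i => (hh i).1) hw hM).comp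
    hline).intervalIntegrable _ _

theorem hasFDerivAt_filtered {h : Fin n → RSpace n → ℝ} (hg : Integrable g)
    (hh : ∀ i, IsWeakPartial g i (h i)) (hw : Continuous w) (hM : ∀ x, ‖w x‖ ≤ M)
    (x : RSpace n) : HasFDerivAt (filtered g w) (gradFiltered h w x) x := by
  have hc : Continuous fun y => ∫ θ in (0 : ℝ)..1, gradFiltered h w (x + θ • (y - x)) := by
    refine intervalIntegral.continuous_parametric_intervalIntegral_of_continuous' ?_ 0 1
    exact (continuous_gradFiltered_apply (fun i => (hh i).1) hw hM).comp
      (f := fun q : RSpace n × ℝ => x + q.2 • (q.1 - x)) (by fun_prop)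
  simpa using hasFDerivAt_of_slope hc.continuousAt (filtered_sub_eq hg hh hw hM x)

theorem contDiff_filtered {h : Fin n → RSpace n → ℝ} (hg : Integrable g)
    (hh : ∀ i, IsWeakPartial g i (h i)) (hw : Continuous w) (hM : ∀ x, ‖w x‖ ≤ M) :
    ContDiff ℝ 1 (filtered g w) :=
  contDiff_one_iff_hasFDerivAt.2 ⟨gradFiltered h w,
    continuous_gradFiltered_apply (fun i => (hh i).1) hw hM, hasFDerivAt_filtered hg hh hw hM⟩

/-- The Lipschitz constant of the convolution with a field bounded by `M`. -/
noncomputable def filteredLip (h : Fin n → RSpace n → ℝ) (M : ℝ) : ℝ≥0 :=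
  Real.toNNReal ((∑ i, ∫ y, ‖h i y‖) * M)

theorem isFieldSlope_filtered {h : Fin n → RSpace n → ℝ} (hg : Integrable g)
    (hh : ∀ i, IsWeakPartial g i (h i)) {w : ℝ → RSpace n → RSpace n}
    (hw : Continuous fun q : ℝ × RSpace n => w q.1 q.2) (hM : ∀ t x, ‖w t x‖ ≤ M) :
    IsFieldSlope (filteredLip h M) (fun t => filtered g (w t))
      (fun t x y => ∫ θ in (0 : ℝ)..1, gradFiltered h (w t) (x + θ • (y - x))) := by
  have hwt : ∀ t, Continuous (w t) := fun t => hw.comp (continuous_const.prodMk continuous_id)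
  refine ⟨?_, fun t x y => ?_, fun t x y => filtered_sub_eq hg hh (hwt t) (hM t) x y⟩
  · refine intervalIntegral.continuous_parametric_intervalIntegral_of_continuous' ?_ 0 1
    exact (continuous_gradFiltered (fun i => (hh i).1) hw hM).comp
      (f := fun q : (ℝ × RSpace n × RSpace n) × ℝ =>
        (q.1.1, q.1.2.1 + q.2 • (q.1.2.2 - q.1.2.1))) (by fun_prop)
  · have h1 : ‖∫ θ in (0 : ℝ)..1, gradFiltered h (w t) (x + θ • (y - x))‖ ≤
        ((∑ i, ∫ y, ‖h i y‖) * M) * |1 - 0| :=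
      intervalIntegral.norm_integral_le_of_norm_le_const fun θ _ =>
        norm_gradFiltered_le (fun i => (hh i).1) (hM t) _
    rw [sub_zero, abs_one, mul_one] at h1
    exact NNReal.le_toNNReal_of_coe_le (by simpa using h1)

theorem lipschitzField_filtered {h : Fin n → RSpace n → ℝ} (hg : Integrable g)
    (hh : ∀ i, IsWeakPartial g i (h i)) {w : ℝ → RSpace n → RSpace n}
    (hw : Continuous fun q : ℝ × RSpace n => w q.1 q.2) (hM : ∀ t x, ‖w t x‖ ≤ M) :
    LipschitzField (filteredLip h M) fun t => filtered g (w t) :=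
  ⟨(isFieldSlope_filtered hg hh hw hM).lipschitzWith, continuous_filtered hg hw hM⟩

end Convolution

/-! ### Essential suprema of continuous functions. -/

section EssSup

theorem eLpNorm_top_le {X F : Type*} [MeasurableSpace X] {μ : Measure X} [NormedAddCommGroup F]
    {f : X → F} {C : ℝ≥0∞} (hf : ∀ x, ‖f x‖ₑ ≤ C) :
    eLpNorm f ∞ μ ≤ C := by
  rw [eLpNorm_exponent_top]
  exact essSup_le_of_ae_le _ (Filter.Eventually.of_forall hf)

variable {X F : Type*} [TopologicalSpace X] [MeasurableSpace X] {μ : Measure X}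
  [μ.IsOpenPosMeasure] [NormedAddCommGroup F]

/-- The set where a continuous function exceeds its essential supremum is open and null, hence
empty. -/
theorem enorm_le_eLpNorm_top {f : X → F} (hf : Continuous f) (x : X) :
    ‖f x‖ₑ ≤ eLpNorm f ∞ μ := by
  rw [eLpNorm_exponent_top]
  by_contra! hlt
  have ho : IsOpen {y | eLpNormEssSup f μ < ‖f y‖ₑ} := isOpen_lt continuous_const hf.enorm
  have h0 : μ {y | eLpNormEssSup f μ < ‖f y‖ₑ} = 0 := by
    have := enorm_ae_le_eLpNormEssSup f μ
    rw [ae_iff] at this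
    simpa only [not_le] using this
  exact ((ho.measure_eq_zero_iff μ).1 h0).subset hlt

/-- For continuous functions the essential supremum is a true supremum, so surjectivity suffices and
`ψ` need not preserve null sets. -/
theorem eLpNorm_top_comp_of_surjective {f : X → F} (hf : Continuous f) {ψ : X → X}
    (hψ : Continuous ψ) (hs : Function.Surjective ψ) :
    eLpNorm (fun x => f (ψ x)) ∞ μ = eLpNorm f ∞ μ := by
  refine le_antisymm (eLpNorm_top_le fun x => enorm_le_eLpNorm_top hf _) (eLpNorm_top_le fun x => ?_)
  obtain ⟨y, rfl⟩ := hs x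
  exact enorm_le_eLpNorm_top (f := fun x => f (ψ x)) (hf.comp hψ) y

end EssSup

/-! ### Pointwise bounds for the filtered field. -/

section FilteredBounds

variable {n : ℕ} {h : RSpace n → ℝ} {w w' : RSpace n → RSpace n} {M : ℝ}

theorem enorm_integral_smul_le {F : Type*} [NormedAddCommGroup F] [NormedSpace ℝ F]
    {w : RSpace n → F} (hh : Integrable h) (hw : Continuous w) (x : RSpace n) :
    ‖∫ y, h y • w (x - y)‖ₑ ≤ eLpNorm h 1 volume * eLpNorm w ∞ volume := by
  refine (enorm_integral_le_lintegral_enorm _).trans ?_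
  rw [eLpNorm_one_eq_lintegral_enorm, ← lintegral_mul_const'' _ hh.1.enorm]
  refine lintegral_mono fun y => ?_
  rw [enorm_smul]
  gcongr
  exact enorm_le_eLpNorm_top hw _

theorem filtered_apply_coord (hh : Integrable h) (hw : Continuous w) (hM : ∀ x, ‖w x‖ ≤ M)
    (x : RSpace n) (j : Fin n) : filtered h w x j = ∫ y, h y • w (x - y) j := by
  rw [filtered_apply, eval_integral_piLp (integrable_filtered hh hw hM x).eval_piLp]
  simp

theorem filtered_sub (hh : Integrable h) (hw : Continuous w) (hM : ∀ x, ‖w x‖ ≤ M)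
    (hw' : Continuous w') (hM' : ∀ x, ‖w' x‖ ≤ M) (x : RSpace n) :
    filtered h w x - filtered h w' x = filtered h (fun y => w y - w' y) x := by
  simp only [filtered_apply, smul_sub]
  rw [integral_sub (integrable_filtered hh hw hM x) (integrable_filtered hh hw' hM' x)]

end FilteredBounds

/-! ### Characteristics, a priori bounds and uniqueness. -/

namespace IsGlobalSolution

open Filter Topology NNReal

variable {n : ℕ} {g : RSpace n → ℝ} {u₀ : RSpace n → RSpace n} {u : ℝ → RSpace n → RSpace n}

/-- The chain rule along an arbitrary curve. For `V = ū` the derivative vanishes; another solution's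
characteristics give the term that drives uniqueness. -/
theorem hasDerivWithinAt_comp (hu : IsGlobalSolution g u₀ u) {X : ℝ → RSpace n} {V : RSpace n}
    {s : ℝ} {A : Set ℝ} (hA : A ⊆ Ici 0) (hs : s ∈ A) (hX : HasDerivWithinAt X V A s) :
    HasDerivWithinAt (fun s => u s (X s))
      (fderiv ℝ (u s) (X s) (V - filtered g (u s) (X s))) A s := by
  have hs0 : s ∈ Ici (0 : ℝ) := hA hs
  have hmem : (s, X s) ∈ Ici (0 : ℝ) ×ˢ (univ : Set (RSpace n)) := ⟨hs0, trivial⟩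
  obtain ⟨U', hU⟩ := (hu.c1.differentiableOn one_ne_zero) (s, X s) hmem
  have h1 : HasFDerivAt (u s) (U'.comp (ContinuousLinearMap.inr ℝ ℝ (RSpace n))) (X s) := by
    rw [← hasFDerivWithinAt_univ]
    exact HasFDerivWithinAt.comp (g := fun p : ℝ × RSpace n => u p.1 p.2) (X s) hU
      (hasFDerivAt_prodMk_right s (X s)).hasFDerivWithinAt (fun y _ => mk_mem_prod hs0 (mem_univ _))
  have h2 : HasDerivWithinAt (fun σ => u σ (X s)) (U' (1, 0)) (Ici 0) s :=
    HasFDerivWithinAt.comp_hasDerivWithinAt (l := fun p : ℝ × RSpace n => u p.1 p.2) s hU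
      (((hasDerivAt_id s).prodMk (hasDerivAt_const s (X s))).hasDerivWithinAt)
      (t := Ici 0 ×ˢ univ) (fun σ hσ => mk_mem_prod hσ (mem_univ _))
  -- The total derivative is only one-sided at time `0`; uniqueness of derivatives within `Ici 0`
  -- identifies its time part with the equation.
  have h3 : U' (1, 0) = -(fderiv ℝ (u s) (X s) (filtered g (u s) (X s))) :=
    (uniqueDiffOn_Ici (0 : ℝ) s hs0).eq_deriv _ h2 (hu.equation s hs0 (X s))
  have h4 : HasDerivWithinAt (fun σ => u σ (X σ)) (U' (1, V)) A s :=
    HasFDerivWithinAt.comp_hasDerivWithinAt (l := fun p : ℝ × RSpace n => u p.1 p.2) s hU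
      ((hasDerivAt_id s).hasDerivWithinAt.prodMk hX) (t := Ici 0 ×ˢ univ)
      (fun σ hσ => mk_mem_prod (hA hσ) (mem_univ _))
  refine h4.congr_deriv ?_
  have h5 : U' (1, V) = U' (1, 0) + U' (0, V) := by rw [← map_add]; simp
  rw [h5, h3, h1.fderiv, map_sub]
  simp [ContinuousLinearMap.comp_apply]
  abel

theorem continuous_comp_time (hu : IsGlobalSolution g u₀ u) {c : ℝ → ℝ} (hc : Continuous c)
    (hc0 : ∀ t, 0 ≤ c t) : Continuous fun q : ℝ × RSpace n => u (c q.1) q.2 :=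
  hu.c1.continuousOn.comp_continuous (f := fun q : ℝ × RSpace n => (c q.1, q.2)) (by fun_prop)
    (fun q => ⟨hc0 _, trivial⟩)

theorem continuous_apply (hu : IsGlobalSolution g u₀ u) {t : ℝ} (ht : 0 ≤ t) : Continuous (u t) :=
  (hu.continuous_comp_time (c := fun _ => t) continuous_const (fun _ => ht)).comp
    (continuous_const.prodMk continuous_id : Continuous fun x => ((0 : ℝ), x))

theorem hasDerivWithinAt_of_curve (hu : IsGlobalSolution g u₀ u) {X : ℝ → RSpace n} {t : ℝ}
    (hX : ∀ s ∈ Icc 0 t, HasDerivWithinAt X (filtered g (u s) (X s)) (Icc 0 t) s) :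
    ∀ s ∈ Icc 0 t, HasDerivWithinAt (fun s => u s (X s)) 0 (Icc 0 t) s := by
  intro s hs
  have := hu.hasDerivWithinAt_comp (A := Icc 0 t) (fun _ h => h.1) hs (hX s hs)
  rwa [sub_self, map_zero] at this

theorem eq_of_curve (hu : IsGlobalSolution g u₀ u) {X : ℝ → RSpace n} {t : ℝ} (ht : 0 ≤ t)
    (hX : ∀ s ∈ Icc 0 t, HasDerivWithinAt X (filtered g (u s) (X s)) (Icc 0 t) s) :
    u t (X t) = u₀ (X 0) := by
  have := (convex_Icc (0 : ℝ) t).norm_image_sub_le_of_norm_hasDerivWithin_le (C := 0)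
    (hu.hasDerivWithinAt_of_curve hX) (by simp) (left_mem_Icc.2 ht) (right_mem_Icc.2 ht)
  rw [zero_mul, norm_le_zero_iff, sub_eq_zero] at this
  rw [this, hu.initial]

/-- The bound on `[0,t]` assumed of a solution serves only to make the velocity Lipschitz; constancy
along the resulting characteristic then improves it to `M`. -/
theorem norm_le (hu : IsGlobalSolution g u₀ u) (hg : MemW11 g) {M : ℝ} (hM : ∀ x, ‖u₀ x‖ ≤ M)
    {t : ℝ} (ht : 0 ≤ t) (x : RSpace n) : ‖u t x‖ ≤ M := by
  obtain ⟨hg1, hg2⟩ := hg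
  choose h hh using hg2
  obtain ⟨C, hC⟩ := hu.bounded t
  -- Clamping time to `[0,t]` gives a field on all of `ℝ` without using bounds beyond `t`.
  have hc : ∀ s, max 0 (min s t) ∈ Icc 0 t := fun s => ⟨le_max_left _ _, max_le ht (min_le_right _ _)⟩
  have hv := lipschitzField_filtered (w := fun s => u (max 0 (min s t))) hg1 hh
    (hu.continuous_comp_time (by fun_prop) fun s => (hc s).1) (fun s => hC _ (hc s))
  have hX := hv.integralCurve_spec t x
  set X := integralCurve (fun s => filtered g (u (max 0 (min s t)))) t x
  have := hu.eq_of_curve (X := X) ht fun s hs => by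
    have h1 := (hX.2 s).hasDerivWithinAt (s := Icc 0 t)
    rwa [min_eq_left hs.2, max_eq_right hs.1] at h1
  rw [hX.1] at this
  rw [this]
  exact hM _

/-- The filtered velocity of a solution, extended to negative times by its initial value. -/
noncomputable def velocity (g : RSpace n → ℝ) (u : ℝ → RSpace n → RSpace n) (t : ℝ) :
    RSpace n → RSpace n := filtered g (u (max t 0))

theorem velocity_of_nonneg {t : ℝ} (ht : 0 ≤ t) : velocity g u t = filtered g (u t) := by
  rw [velocity, max_eq_left ht]

variable {h : Fin n → RSpace n → ℝ} {M : ℝ}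

theorem lipschitzField_velocity (hu : IsGlobalSolution g u₀ u) (hg : MemW11 g)
    (hh : ∀ i, IsWeakPartial g i (h i)) (hM : ∀ x, ‖u₀ x‖ ≤ M) :
    LipschitzField (filteredLip h M) (velocity g u) :=
  lipschitzField_filtered hg.1 hh (hu.continuous_comp_time (continuous_id.max continuous_const) fun _ => le_max_right _ _)
    fun _ => hu.norm_le hg hM (le_max_right _ _)

theorem exists_isFieldSlope_velocity (hu : IsGlobalSolution g u₀ u) (hg : MemW11 g)
    (hh : ∀ i, IsWeakPartial g i (h i)) (hM : ∀ x, ‖u₀ x‖ ≤ M) :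
    ∃ S, IsFieldSlope (filteredLip h M) (velocity g u) S :=
  ⟨_, isFieldSlope_filtered hg.1 hh
    (hu.continuous_comp_time (continuous_id.max continuous_const) fun _ => le_max_right _ _)
    fun _ => hu.norm_le hg hM (le_max_right _ _)⟩

theorem eq_comp_backFlow (hu : IsGlobalSolution g u₀ u) (hg : MemW11 g)
    (hM : ∀ x, ‖u₀ x‖ ≤ M) {t : ℝ} (ht : 0 ≤ t) (x : RSpace n) :
    u t x = u₀ (backFlow (velocity g u) t x) := by
  choose h hh using hg.2
  have hX := (hu.lipschitzField_velocity hg hh hM).integralCurve_spec t x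
  have := hu.eq_of_curve (X := integralCurve (velocity g u) t x) ht fun s hs => by
    have h1 := (hX.2 s).hasDerivWithinAt (s := Icc 0 t)
    rwa [velocity_of_nonneg hs.1] at h1
  rwa [hX.1] at this

theorem norm_fderiv_le (hu : IsGlobalSolution g u₀ u) (hg : MemW11 g) (hu₀ : ContDiff ℝ 1 u₀)
    (hh : ∀ i, IsWeakPartial g i (h i))
    (hM : ∀ x, ‖u₀ x‖ ≤ M) {K : ℝ} (hK : ∀ x, ‖fderiv ℝ u₀ x‖ ≤ K) {t T : ℝ} (ht : t ∈ Icc 0 T)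
    (x : RSpace n) : ‖fderiv ℝ (u t) x‖ ≤ K * Real.exp (filteredLip h M * T) := by
  have hK0 : 0 ≤ K := (norm_nonneg _).trans (hK 0)
  have hv := hu.lipschitzField_velocity hg hh hM
  have hlip : LipschitzWith (⟨K * Real.exp (filteredLip h M * T), by positivity⟩ : ℝ≥0) (u t) := by
    refine LipschitzWith.of_dist_le_mul fun y z => ?_
    rw [hu.eq_comp_backFlow hg hM ht.1, hu.eq_comp_backFlow hg hM ht.1]
    have h0 : LipschitzWith (⟨K, hK0⟩ : ℝ≥0) u₀ :=
      lipschitzWith_of_nnnorm_fderiv_le (hu₀.differentiable one_ne_zero) hK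
    have h1 := hv.dist_backFlow_le t t y z
    rw [dist_self, add_zero, abs_of_nonneg ht.1] at h1
    refine (h0.dist_le_mul _ _).trans ?_
    change K * _ ≤ K * Real.exp _ * _
    rw [mul_assoc, mul_comm (Real.exp _)]
    gcongr
    refine h1.trans ?_
    gcongr
    exact ht.2
  exact norm_fderiv_le_of_lipschitz ℝ hlip

/-- Each round integrates `K ‖g‖₁` times the previous bound along a characteristic of `u`. Only the
gradient of `w` enters. -/
theorem norm_sub_le (hu : IsGlobalSolution g u₀ u) {w : ℝ → RSpace n → RSpace n}
    (hw : IsGlobalSolution g u₀ w) (hg : MemW11 g) (hM : ∀ x, ‖u₀ x‖ ≤ M) {K T : ℝ}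
    (hK : ∀ t ∈ Icc 0 T, ∀ x, ‖fderiv ℝ (w t) x‖ ≤ K) (k : ℕ) :
    ∀ t ∈ Icc 0 T, ∀ x, ‖w t x - u t x‖ ≤ 2 * M * ((K * (∫ y, ‖g y‖) * t) ^ k / k.factorial) := by
  choose h hh using hg.2
  have hv := hu.lipschitzField_velocity hg hh hM
  set C : ℝ := K * (∫ y, ‖g y‖) with hC
  induction k with
  | zero =>
    intro t ht x
    have h1 := hu.norm_le hg hM ht.1 x
    have h2 := hw.norm_le hg hM ht.1 x
    simpa using (_root_.norm_sub_le _ _).trans (by linarith)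
  | succ k ih =>
    intro t ht x
    have hX := hv.integralCurve_spec t x
    set X := integralCurve (velocity g u) t x
    have hsub : Icc 0 t ⊆ Icc 0 T := Icc_subset_Icc_right ht.2
    have hXd : ∀ s ∈ Icc 0 t, HasDerivWithinAt X (filtered g (u s) (X s)) (Icc 0 t) s := by
      intro s hs
      have h1 := (hX.2 s).hasDerivWithinAt (s := Icc 0 t)
      rwa [velocity_of_nonneg hs.1] at h1
    have hd : ∀ s ∈ Icc 0 t, HasDerivWithinAt (fun s => w s (X s) - u s (X s))
        (fderiv ℝ (w s) (X s) (filtered g (u s) (X s) - filtered g (w s) (X s))) (Icc 0 t) s := by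
      intro s hs
      have h1 := hw.hasDerivWithinAt_comp (A := Icc 0 t) (fun _ h => h.1) hs (hXd s hs)
      simpa using h1.fun_sub (hu.hasDerivWithinAt_of_curve hXd s hs)
    have hB : ∀ s, HasDerivAt (fun s => 2 * M * ((C * s) ^ (k + 1) / (k + 1).factorial))
        (2 * M * C * ((C * s) ^ k / k.factorial)) s := by
      intro s
      have h1 := ((((hasDerivAt_id s).const_mul C).fun_pow (k + 1)).div_const
        ((k + 1).factorial : ℝ)).const_mul (2 * M)
      refine h1.congr_deriv ?_
      rw [Nat.factorial_succ]
      push_cast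
      simp only [id]
      field_simp
    have := image_norm_le_of_norm_deriv_right_le_deriv_boundary
      (f := fun s => w s (X s) - u s (X s)) (a := 0) (b := t)
      (fun s hs => (hd s hs).continuousWithinAt)
      (fun s hs => (hd s (Ico_subset_Icc_self hs)).mono_of_mem_nhdsWithin
        (Icc_mem_nhdsGE_of_mem hs)) (by simp [hu.initial, hw.initial]) hB
      (fun s hs => ?_) (right_mem_Icc.2 ht.1)
    · rwa [hX.1] at this
    · have hs' := hsub (Ico_subset_Icc_self hs)
      rw [← norm_neg, ← map_neg, neg_sub, filtered_sub hg.1 (hw.continuous_apply hs.1)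
        (hw.norm_le hg hM hs.1) (hu.continuous_apply hs.1) (hu.norm_le hg hM hs.1)]
      refine (ContinuousLinearMap.le_opNorm _ _).trans ?_
      have h1 := norm_filtered_le hg.1 (ih s hs') (X s)
      have hK0 : 0 ≤ K := (norm_nonneg _).trans (hK s hs' 0)
      calc _ ≤ K * ((∫ y, ‖g y‖) * (2 * M * ((C * s) ^ k / k.factorial))) := by
            gcongr
            exact hK s hs' _
        _ = _ := by rw [hC]; ring

theorem unique (hu : IsGlobalSolution g u₀ u) {w : ℝ → RSpace n → RSpace n}
    (hw : IsGlobalSolution g u₀ w) (hg : MemW11 g) (hu₀ : ContDiff ℝ 1 u₀)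
    (hM : ∀ x, ‖u₀ x‖ ≤ M) {K : ℝ} (hK : ∀ x, ‖fderiv ℝ u₀ x‖ ≤ K) {t : ℝ} (ht : 0 ≤ t) :
    u t = w t := by
  choose h hh using hg.2
  ext1 x
  have hlim := ((FloorSemiring.tendsto_pow_div_factorial_atTop
    (K * Real.exp (filteredLip h M * t) * (∫ y, ‖g y‖) * t)).const_mul (2 * M))
  rw [mul_zero] at hlim
  have := ge_of_tendsto' hlim fun k => hu.norm_sub_le hw hg hM
    (fun s hs => hw.norm_fderiv_le hg hu₀ hh hM hK hs) k t ⟨ht, le_rfl⟩ x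
  exact (sub_eq_zero.1 (norm_le_zero_iff.1 this)).symm

end IsGlobalSolution

/-! ### Extraction of pointwise convergent subsequences. -/

section Compactness

open Filter Topology

/-- A pointwise bounded equicontinuous sequence on a separable space has a subsequence that
converges pointwise. -/
theorem Equicontinuous.exists_subseq_tendsto {X F : Type*} [TopologicalSpace X]
    [TopologicalSpace.SeparableSpace X] [MetricSpace F] [ProperSpace F] {f : ℕ → X → F}
    (hf : Equicontinuous f) (hb : ∀ x, Bornology.IsBounded (range fun k => f k x)) :
    ∃ σ : ℕ → ℕ, StrictMono σ ∧ ∃ f' : X → F, ∀ x, Tendsto (fun k => f (σ k) x) atTop (𝓝 (f' x)) := by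
  obtain ⟨D, hDc, hD⟩ := TopologicalSpace.exists_countable_dense X
  have : Countable D := hDc.to_subtype
  -- Sequential compactness of a countable product replaces the diagonal argument on the dense set;
  -- equicontinuity then gives Cauchy sequences everywhere.
  have hK : IsCompact (univ.pi fun d : D => closure (range fun k => f k d)) :=
    isCompact_univ_pi fun d => (hb d).isCompact_closure
  obtain ⟨a, -, σ, hσ, hlim⟩ := hK.tendsto_subseq (x := fun k (d : D) => f k d)
    (fun k d _ => subset_closure ⟨k, rfl⟩)
  rw [tendsto_pi_nhds] at hlim
  refine ⟨σ, hσ, ?_⟩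
  have hcauchy : ∀ x, CauchySeq fun k => f (σ k) x := by
    intro x
    rw [Metric.cauchySeq_iff]
    intro ε hε
    have h1 := Metric.equicontinuousAt_iff_right.1 (hf x) (ε / 3) (by positivity)
    obtain ⟨d, hd, hdD⟩ := mem_closure_iff_nhds.1 (hD x) _ h1
    obtain ⟨N, hN⟩ := Metric.cauchySeq_iff.1 (hlim ⟨d, hdD⟩).cauchySeq (ε / 3) (by positivity)
    refine ⟨N, fun m hm k hk => ?_⟩
    have h2 : dist (f (σ m) d) (f (σ k) d) < ε / 3 := hN m hm k hk
    have h3 : dist (f (σ m) x) (f (σ m) d) < ε / 3 := hd (σ m)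
    have h4 : dist (f (σ k) x) (f (σ k) d) < ε / 3 := hd (σ k)
    rw [dist_comm] at h4
    linarith [dist_triangle4 (f (σ m) x) (f (σ m) d) (f (σ k) d) (f (σ k) x)]
  choose f' hf' using fun x => cauchySeq_tendsto_of_complete (hcauchy x)
  exact ⟨f', hf'⟩

end Compactness

/-! ### Stability of the backward flow. -/

section Stability

open Filter Topology NNReal

variable {E : Type*} [NormedAddCommGroup E] [NormedSpace ℝ E] [CompleteSpace E] {K : ℝ≥0}

theorem LipschitzField.backFlow_zero {v : ℝ → E → E} (hv : LipschitzField K v) (x : E) :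
    backFlow v 0 x = x := (hv.integralCurve_spec 0 x).1

/-- The backward flow depends continuously on the field, for pointwise bounded convergence. -/
theorem tendsto_backFlow {V : ℕ → ℝ → E → E} {v : ℝ → E → E}
    (hV : ∀ k, LipschitzField K (V k)) (hv : LipschitzField K v) {C : ℝ}
    (hVC : ∀ k t x, ‖V k t x‖ ≤ C) (hvC : ∀ t x, ‖v t x‖ ≤ C)
    (hlim : ∀ t x, Tendsto (fun k => V k t x) atTop (𝓝 (v t x))) {t : ℝ} (ht : 0 ≤ t) (x : E) :
    Tendsto (fun k => backFlow (V k) t x) atTop (𝓝 (backFlow v t x)) := by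
  set X := integralCurve v t x with hXdef
  have hX := hv.integralCurve_spec t x
  rw [← hXdef] at hX
  have hXc : Continuous X := continuous_iff_continuousAt.2 fun s => (hX.2 s).continuousAt
  have hdc : ∀ k, Continuous fun r => V k r (X r) - v r (X r) := fun k =>
    ((hV k).cont.comp (continuous_id.prodMk hXc)).sub (hv.cont.comp (continuous_id.prodMk hXc))
  set δ : ℕ → ℝ := fun k => ∫ r in (0 : ℝ)..t, ‖V k r (X r) - v r (X r)‖ with hδ
  have hδlim : Tendsto δ atTop (𝓝 0) := by
    have : Tendsto δ atTop (𝓝 (∫ r in (0 : ℝ)..t, (0 : ℝ))) := by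
      refine intervalIntegral.tendsto_integral_filter_of_dominated_convergence (fun _ => C + C)
        (Eventually.of_forall fun k => (hdc k).norm.aestronglyMeasurable)
        (Eventually.of_forall fun k => Eventually.of_forall fun r _ => ?_)
        intervalIntegrable_const (Eventually.of_forall fun r _ => ?_)
      · rw [norm_norm]
        exact (norm_sub_le _ _).trans (add_le_add (hVC ..) (hvC ..))
      · have := ((hlim r (X r)).sub_const (v r (X r))).norm
        rwa [sub_self, norm_zero] at this
    simpa using this
  have hδ0 : ∀ k, 0 ≤ δ k := fun k => intervalIntegral.integral_nonneg ht fun _ _ => norm_nonneg _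
  -- The error of the field along `X` is small only in the mean. The shifted curve `X + e k` has
  -- velocity exactly `V k s (X s)`, so its defect as a solution for `V k` is at most `K ‖e k s‖ ≤ K
  -- δ k`.
  let e : ℕ → ℝ → E := fun k s => ∫ r in t..s, (V k r (X r) - v r (X r))
  have he : ∀ k, ∀ s ∈ Icc 0 t, ‖e k s‖ ≤ δ k := by
    intro k s hs
    change ‖∫ r in t..s, (V k r (X r) - v r (X r))‖ ≤ _
    rw [intervalIntegral.integral_symm, norm_neg]
    refine (intervalIntegral.norm_integral_le_integral_norm hs.2).trans ?_
    exact intervalIntegral.integral_mono_interval hs.1 hs.2 le_rfl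
      (Eventually.of_forall fun _ => norm_nonneg _) ((hdc k).norm.intervalIntegrable _ _)
  have hY : ∀ k s, HasDerivAt (fun s => X s + e k s) (V k s (X s)) s := by
    intro k s
    have h1 := intervalIntegral.integral_hasDerivAt_right ((hdc k).intervalIntegrable t s)
      ((hdc k).stronglyMeasurableAtFilter _ _) (hdc k).continuousAt
    exact ((hX.2 s).fun_add h1).congr_deriv (by simp)
  have key : ∀ k, dist (backFlow (V k) t x) (backFlow v t x) ≤
      K * δ k * t * Real.exp (K * t) + δ k := by
    intro k
    have hXk := (hV k).integralCurve_spec t x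
    have h1 := dist_le_of_approx_solution (f := V k) (K := K) (a := 0) (b := t) (t₀ := t) (t := 0)
      (X := integralCurve (V k) t x) (Y := fun s => X s + e k s)
      (ε := 0) (η := K * δ k)
      (fun s _ => (hV k).lip s) ⟨ht, le_rfl⟩ (fun s _ => (hXk.2 s).hasDerivWithinAt)
      (fun s _ => (hY k s).hasDerivWithinAt) (by simp) (fun s hs => by
        refine ((hV k).lip s).dist_le_mul_of_le ?_
        rw [dist_self_add_right]
        exact he k s hs) ⟨le_rfl, ht⟩
    have h2 : dist (X 0 + e k 0) (X 0) ≤ δ k := by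
      rw [dist_self_add_left]; exact he k 0 ⟨le_rfl, ht⟩
    have h3 : e k t = 0 := intervalIntegral.integral_same
    simp only [hXk.1, hX.1, h3, add_zero, dist_self, zero_add, sub_zero] at h1
    exact (dist_triangle _ (X 0 + e k 0) _).trans (add_le_add h1 h2)
  refine tendsto_iff_dist_tendsto_zero.2 (squeeze_zero (fun _ => dist_nonneg) key ?_)
  have := ((((hδlim.const_mul (K : ℝ)).mul_const t).mul_const (Real.exp (K * t))).add hδlim)
  simpa using this

end Stability

/-! ### Existence through retarded velocities. -/

section Existence

open Filter Topology NNReal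

variable {n : ℕ} {g : RSpace n → ℝ} {u₀ : RSpace n → RSpace n} {h : Fin n → RSpace n → ℝ} {M : ℝ}

/-- The filtered velocity, at a time retarded by `ε`, of the field transported by `ψ`. -/
noncomputable def retarded (g : RSpace n → ℝ) (u₀ : RSpace n → RSpace n) (ε : ℝ)
    (ψ : ℝ → RSpace n → RSpace n) (t : ℝ) : RSpace n → RSpace n :=
  filtered g fun x => u₀ (ψ (max (t - ε) 0) x)

/-- The iteration that solves the transport equation with retarded velocity. -/
noncomputable def retardedIter (g : RSpace n → ℝ) (u₀ : RSpace n → RSpace n) (ε : ℝ) :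
    ℕ → ℝ → RSpace n → RSpace n
  | 0 => fun _ x => x
  | k + 1 => backFlow (retarded g u₀ ε (retardedIter g u₀ ε k))

theorem lipschitzField_retarded (hg : Integrable g) (hh : ∀ i, IsWeakPartial g i (h i))
    (hu₀ : Continuous u₀) (hM : ∀ x, ‖u₀ x‖ ≤ M) (ε : ℝ) {ψ : ℝ → RSpace n → RSpace n}
    (hψ : Continuous fun q : ℝ × RSpace n => ψ q.1 q.2) :
    LipschitzField (filteredLip h M) (retarded g u₀ ε ψ) :=
  lipschitzField_filtered (w := fun t x => u₀ (ψ (max (t - ε) 0) x)) hg hh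
    (hu₀.comp (hψ.comp (f := fun q : ℝ × RSpace n => (max (q.1 - ε) 0, q.2))
      (((continuous_fst.sub continuous_const).max continuous_const).prodMk continuous_snd)))
    fun _ _ => hM _

theorem continuous_retardedIter (hg : Integrable g) (hh : ∀ i, IsWeakPartial g i (h i))
    (hu₀ : Continuous u₀) (hM : ∀ x, ‖u₀ x‖ ≤ M) (ε : ℝ) (k : ℕ) :
    Continuous fun q : ℝ × RSpace n => retardedIter g u₀ ε k q.1 q.2 := by
  induction k with
  | zero => exact continuous_snd
  | succ k ih => exact (lipschitzField_retarded hg hh hu₀ hM ε ih).continuous_backFlow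

/-- Up to time `(k + 1) ε` the retarded velocity sees its argument only up to time `k ε`, where
consecutive iterates already agree. -/
theorem retardedIter_succ_eq (hg : Integrable g) (hh : ∀ i, IsWeakPartial g i (h i))
    (hu₀ : Continuous u₀) (hM : ∀ x, ‖u₀ x‖ ≤ M) {ε : ℝ} (hε : 0 ≤ ε) (k : ℕ) :
    ∀ t ∈ Icc 0 (k * ε), retardedIter g u₀ ε (k + 1) t = retardedIter g u₀ ε k t := by
  have hL := fun k => lipschitzField_retarded hg hh hu₀ hM ε
    (continuous_retardedIter hg hh hu₀ hM ε k)
  induction k with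
  | zero =>
    intro t ht
    have : t = 0 := by simpa using ht
    subst this
    ext1 x
    exact (hL 0).backFlow_zero x
  | succ k ih =>
    intro t ht
    ext1 x
    have hX := (hL k).integralCurve_spec t x
    have := (hL (k + 1)).backFlow_eq (t := t)
      (X := integralCurve (retarded g u₀ ε (retardedIter g u₀ ε k)) t x) ht.1 fun s hs => by
      have h1 : retarded g u₀ ε (retardedIter g u₀ ε (k + 1)) s =
          retarded g u₀ ε (retardedIter g u₀ ε k) s := by
        rw [retarded, retarded, ih]
        refine ⟨le_max_right _ _, max_le ?_ (by positivity)⟩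
        have := hs.2.trans ht.2
        push_cast at this
        linarith
      rw [h1]
      exact (hX.2 s).hasDerivWithinAt
    rw [hX.1] at this
    exact this

/-- Approximate solutions: the velocity is retarded by `1 / (N + 1)`. -/
theorem exists_retarded_solution (hg : Integrable g) (hh : ∀ i, IsWeakPartial g i (h i))
    (hu₀ : Continuous u₀) (hM : ∀ x, ‖u₀ x‖ ≤ M) (N : ℕ) :
    ∃ V : ℝ → RSpace n → RSpace n, LipschitzField (filteredLip h M) V ∧
      (∀ t x, ‖V t x‖ ≤ (∫ y, ‖g y‖) * M) ∧
      ∀ t ≤ (N : ℝ), V t = retarded g u₀ (1 / ((N : ℝ) + 1)) (backFlow V) t := by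
  set ε : ℝ := 1 / ((N : ℝ) + 1) with hε
  have hε0 : 0 < ε := by positivity
  -- After `(N + 1) * N` iterations of delay `1 / (N + 1)` the iterates are stationary up to time
  -- `N`.
  refine ⟨retarded g u₀ ε (retardedIter g u₀ ε ((N + 1) * N)),
    lipschitzField_retarded hg hh hu₀ hM ε (continuous_retardedIter hg hh hu₀ hM ε _),
    fun t x => norm_filtered_le hg (fun _ => hM _) x, fun t ht => ?_⟩
  change filtered g _ = filtered g fun x => u₀ (retardedIter g u₀ ε ((N + 1) * N + 1) _ x)
  rw [retardedIter_succ_eq hg hh hu₀ hM hε0.le]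
  refine ⟨le_max_right _ _, max_le ?_ (by positivity)⟩
  have : (((N + 1) * N : ℕ) : ℝ) * ε = N := by rw [hε]; push_cast; field_simp
  linarith

/-- The velocity of a solution, as a limit of retarded velocities. -/
theorem exists_velocity (hg : Integrable g) (hh : ∀ i, IsWeakPartial g i (h i))
    (hu₀ : Continuous u₀) (hM : ∀ x, ‖u₀ x‖ ≤ M) :
    ∃ v S, LipschitzField (filteredLip h M) v ∧ IsFieldSlope (filteredLip h M) v S ∧
      ∀ t, 0 ≤ t → v t = filtered g fun x => u₀ (backFlow v t x) := by
  choose V hV hVC hVe using exists_retarded_solution hg hh hu₀ hM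
  set L := filteredLip h M
  set C : ℝ := (∫ y, ‖g y‖) * M
  have heq : Equicontinuous fun N (q : ℝ × RSpace n) => backFlow (V N) q.1 q.2 := by
    rintro ⟨t₀, x₀⟩
    refine Metric.equicontinuousAt_of_continuity_modulus
      (fun q : ℝ × RSpace n => (dist q.2 x₀ + C * |q.1 - t₀|) * Real.exp (L * |q.1|)) ?_ _
      (Eventually.of_forall fun q N => ?_)
    · have : Continuous fun q : ℝ × RSpace n =>
        (dist q.2 x₀ + C * |q.1 - t₀|) * Real.exp (L * |q.1|) := by fun_prop
      simpa using this.tendsto (t₀, x₀)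
    · rw [dist_comm]
      exact (hV N).dist_backFlow_le_of_bounded (hVC N) ..
  have hbd : ∀ q : ℝ × RSpace n, Bornology.IsBounded (range fun N => backFlow (V N) q.1 q.2) := by
    rintro ⟨t, x⟩
    refine Metric.isBounded_closedBall (x := x) (r := (dist x x + C * |t - 0|) * Real.exp (L * |t|))
      |>.subset ?_
    rintro _ ⟨N, rfl⟩
    have := (hV N).dist_backFlow_le_of_bounded (hVC N) t 0 x x
    rwa [(hV N).backFlow_zero] at this
  obtain ⟨σ, hσ, ψ, hψ⟩ := heq.exists_subseq_tendsto hbd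
  have hψc : Continuous ψ := by
    have h1 : Equicontinuous fun k (q : ℝ × RSpace n) => backFlow (V (σ k)) q.1 q.2 := heq.comp σ
    exact Filter.Tendsto.continuous_of_equicontinuous (tendsto_pi_nhds.2 hψ) h1
  let w : ℝ → RSpace n → RSpace n := fun t x => u₀ (ψ (max t 0, x))
  have hw : Continuous fun q : ℝ × RSpace n => w q.1 q.2 :=
    hu₀.comp (hψc.comp ((continuous_fst.max continuous_const).prodMk continuous_snd))
  have hwM : ∀ t x, ‖w t x‖ ≤ M := fun _ _ => hM _
  have hv : LipschitzField L fun t => filtered g (w t) := lipschitzField_filtered hg hh hw hwM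
  have hε : Tendsto (fun k => 1 / (((σ k : ℕ) : ℝ) + 1)) atTop (𝓝 0) :=
    tendsto_one_div_add_atTop_nhds_zero_nat.comp hσ.tendsto_atTop
  have hlim : ∀ t x, Tendsto (fun k => V (σ k) t x) atTop (𝓝 (filtered g (w t) x)) := by
    intro t x
    set s : ℕ → ℝ := fun k => max (t - 1 / (((σ k : ℕ) : ℝ) + 1)) 0 with hs
    have hslim : Tendsto s atTop (𝓝 (max t 0)) := by
      have := (hε.const_sub t).max (tendsto_const_nhds (x := (0 : ℝ)))
      rwa [sub_zero] at this
    -- The evaluation time `s k` moves with `k`; the common modulus of continuity reduces this to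
    -- convergence at its limit `max t 0`.
    have hpt : ∀ y, Tendsto (fun k => backFlow (V (σ k)) (s k) y) atTop (𝓝 (ψ (max t 0, y))) := by
      intro y
      refine (hψ (max t 0, y)).congr_dist ?_
      refine squeeze_zero (fun _ => dist_nonneg) (fun k => ?_)
        (g := fun k => (dist y y + C * |s k - max t 0|) * Real.exp (L * |s k|)) ?_
      · rw [dist_comm]
        exact (hV (σ k)).dist_backFlow_le_of_bounded (hVC (σ k)) ..
      · have h1 := (((hslim.sub_const (max t 0)).abs.const_mul C).const_add (dist y y)).mul
          (((hslim.abs.const_mul (L : ℝ))).rexp)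
        simpa using h1
    have hVs : ∀ k, Continuous fun y => u₀ (backFlow (V (σ k)) (s k) y) := fun k =>
      hu₀.comp ((hV (σ k)).continuous_backFlow.comp (continuous_const.prodMk continuous_id))
    refine (tendsto_filtered hg hVs (fun _ _ => hM _)
      (fun y => (hu₀.tendsto _).comp (hpt y)) x).congr' ?_
    obtain ⟨N, hN⟩ := exists_nat_ge t
    filter_upwards [eventually_ge_atTop N] with k hk
    have h1 : (N : ℝ) ≤ σ k := by exact_mod_cast hk.trans (hσ.id_le k)
    rw [hVe (σ k) t (hN.trans h1)]
    rfl
  refine ⟨fun t => filtered g (w t), _, hv, isFieldSlope_filtered hg hh hw hwM, fun t ht => ?_⟩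
  -- By stability `ψ` is the backward flow of the very field it defines, so the fixed-point equation
  -- holds.
  have hback : ∀ x, ψ (t, x) = backFlow (fun t => filtered g (w t)) t x := fun x =>
    tendsto_nhds_unique (hψ (t, x)) (tendsto_backFlow (fun k => hV (σ k)) hv (fun k => hVC (σ k))
      (fun t x => norm_filtered_le hg (hwM t) x) hlim ht x)
  simp only [← hback, w, max_eq_left ht]

theorem isGlobalSolution_of_velocity {K : ℝ≥0} {v : ℝ → RSpace n → RSpace n}
    {S : ℝ → RSpace n → RSpace n → RSpace n →L[ℝ] RSpace n} (hv : LipschitzField K v)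
    (hS : IsFieldSlope K v S) (hu₀ : ContDiff ℝ 1 u₀) (hM : ∀ x, ‖u₀ x‖ ≤ M)
    (hve : ∀ t, 0 ≤ t → v t = filtered g fun x => u₀ (backFlow v t x)) :
    IsGlobalSolution g u₀ fun t x => u₀ (backFlow v t x) := by
  have hU : ContDiff ℝ 1 fun q : ℝ × RSpace n => u₀ (backFlow v q.1 q.2) :=
    hu₀.comp (hv.contDiff_backFlow hS)
  refine ⟨hU.contDiffOn, fun T => ⟨M, fun _ _ _ => hM _⟩, fun t ht x => ?_,
    fun x => by rw [hv.backFlow_zero]⟩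
  rw [← hve t ht]
  have hd : HasFDerivAt (fun q : ℝ × RSpace n => u₀ (backFlow v q.1 q.2)) _ (t, x) :=
    (hU.differentiable one_ne_zero (t, x)).hasFDerivAt
  set U' := fderiv ℝ (fun q : ℝ × RSpace n => u₀ (backFlow v q.1 q.2)) (t, x)
  have h1 : HasFDerivAt (fun y => u₀ (backFlow v t y))
      (U'.comp (ContinuousLinearMap.inr ℝ ℝ (RSpace n))) x :=
    hd.comp x (hasFDerivAt_prodMk_right t x)
  have h2 : HasDerivAt (fun s => u₀ (backFlow v s x)) (U' (1, 0)) t :=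
    HasFDerivAt.comp_hasDerivAt (l := fun q : ℝ × RSpace n => u₀ (backFlow v q.1 q.2)) t hd
      ((hasDerivAt_id t).prodMk (hasDerivAt_const t x))
  -- The field is constant along its flow lines, so its derivative in the direction `(1, v)`
  -- vanishes.
  have h3 : U' (1, v t x) = 0 := by
    have hf := hv.hasDerivAt_flow (backFlow v t x) t
    rw [hv.flow_backFlow] at hf
    have hc := (hasDerivAt_id t).prodMk hf
    have hd' : HasFDerivAt (fun q : ℝ × RSpace n => u₀ (backFlow v q.1 q.2)) U'
        (id t, flow v t (backFlow v t x)) := by rw [hv.flow_backFlow]; exact hd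
    have h4 : HasDerivAt (fun s => u₀ (backFlow v s (flow v s (backFlow v t x))))
        (U' (1, v t x)) t := HasFDerivAt.comp_hasDerivAt
      (l := fun q : ℝ × RSpace n => u₀ (backFlow v q.1 q.2)) t hd' hc
    simp only [hv.backFlow_flow] at h4
    exact h4.unique (hasDerivAt_const t _)
  have h5 : U' (1, v t x) = U' (1, 0) + U' (0, v t x) := by rw [← map_add]; simp
  refine h2.hasDerivWithinAt.congr_deriv ?_
  rw [h1.fderiv, ContinuousLinearMap.comp_apply, ContinuousLinearMap.inr_apply,
    eq_neg_iff_add_eq_zero, ← h5, h3]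

theorem exists_isGlobalSolution (hg : MemW11 g) (hu₀ : ContDiff ℝ 1 u₀) (hM : ∀ x, ‖u₀ x‖ ≤ M) :
    ∃ u, IsGlobalSolution g u₀ u := by
  choose h hh using hg.2
  obtain ⟨v, S, hv, hS, hve⟩ := exists_velocity hg.1 hh hu₀.continuous hM
  exact ⟨_, isGlobalSolution_of_velocity hv hS hu₀ hM hve⟩

end Existence

/-! ### Gradient bounds for the filtered velocity. -/

section GradientBound

variable {n : ℕ} {g h : RSpace n → ℝ} {w : RSpace n → RSpace n} {M : ℝ}

theorem fderiv_filtered_basisVec (hg : MemW11 g) {i : Fin n} (hh : IsWeakPartial g i h)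
    (hw : Continuous w) (hM : ∀ x, ‖w x‖ ≤ M) (x : RSpace n) :
    fderiv ℝ (filtered g w) x (basisVec i) = filtered h w x := by
  choose d hd using hg.2
  -- Putting the given `h` into a chosen family of weak partials avoids any appeal to their
  -- uniqueness.
  have hd' : ∀ j, IsWeakPartial g j (Function.update d i h j) := by
    intro j
    rcases eq_or_ne j i with rfl | hj
    · simpa using hh
    · simpa [hj] using hd j
  rw [(hasFDerivAt_filtered hg.1 hd' hw hM x).fderiv, gradFiltered_basisVec, Function.update_self]

theorem eLpNorm_fderiv_filtered_le (hg : MemW11 g) {i : Fin n} (hh : IsWeakPartial g i h)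
    (hw : Continuous w) (hM : ∀ x, ‖w x‖ ≤ M) :
    eLpNorm (fun x => fderiv ℝ (filtered g w) x (basisVec i)) ∞ volume
      ≤ eLpNorm h 1 volume * eLpNorm w ∞ volume := by
  refine eLpNorm_top_le fun x => ?_
  rw [fderiv_filtered_basisVec hg hh hw hM, filtered_apply]
  exact enorm_integral_smul_le hh.1 hw x

theorem eLpNorm_fderiv_filtered_coord_le (hg : MemW11 g) {i : Fin n} (hh : IsWeakPartial g i h)
    (hw : Continuous w) (hM : ∀ x, ‖w x‖ ≤ M) (j : Fin n) :
    eLpNorm (fun x => fderiv ℝ (filtered g w) x (basisVec i) j) ∞ volume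
      ≤ eLpNorm h 1 volume * eLpNorm (fun x => w x j) ∞ volume := by
  refine eLpNorm_top_le fun x => ?_
  rw [fderiv_filtered_basisVec hg hh hw hM, filtered_apply_coord hh.1 hw hM]
  exact enorm_integral_smul_le (w := fun x => w x j) hh.1 (by fun_prop) x

end GradientBound

/-! ### Conservation of sup norms, the flow representation, and the main theorem. -/

namespace IsGlobalSolution

variable {n : ℕ} {g : RSpace n → ℝ} {u₀ : RSpace n → RSpace n} {u : ℝ → RSpace n → RSpace n}

theorem eLpNorm_top_comp_eq (hu : IsGlobalSolution g u₀ u) (hg : MemW11 g) {M : ℝ}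
    (hM : ∀ x, ‖u₀ x‖ ≤ M) {F : Type*} [NormedAddCommGroup F] {p : RSpace n → F}
    (hp : Continuous fun x => p (u₀ x)) {t : ℝ} (ht : 0 ≤ t) :
    eLpNorm (fun x => p (u t x)) ∞ volume = eLpNorm (fun x => p (u₀ x)) ∞ volume := by
  choose h hh using hg.2
  have hv := hu.lipschitzField_velocity hg hh hM
  simp only [fun x => hu.eq_comp_backFlow hg hM ht x]
  exact eLpNorm_top_comp_of_surjective hp
    (hv.continuous_backFlow.comp (continuous_const.prodMk continuous_id : Continuous fun x => (t, x)))
    (fun ξ => ⟨_, hv.backFlow_flow t ξ⟩)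

theorem exists_flow (hu : IsGlobalSolution g u₀ u) (hg : MemW11 g) {M : ℝ}
    (hM : ∀ x, ‖u₀ x‖ ≤ M) :
    ∃ φ ψ : ℝ → RSpace n → RSpace n,
      IsFlow (fun t => filtered g (u t)) φ ∧ IsC1 φ ∧ IsC1 ψ ∧
      ∀ t, 0 ≤ t →
        Function.LeftInverse (ψ t) (φ t) ∧ Function.RightInverse (ψ t) (φ t) ∧
        (∀ ξ, (fderiv ℝ (φ t) ξ).det ≠ 0) ∧ (∀ x, u t x = u₀ (ψ t x)) := by
  choose h hh using hg.2
  have hv := hu.lipschitzField_velocity hg hh hM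
  obtain ⟨S, hS⟩ := hu.exists_isFieldSlope_velocity hg hh hM
  refine ⟨flow (velocity g u), backFlow (velocity g u), ⟨hv.flow_zero, fun t ht ξ => ?_⟩,
    (hv.contDiff_flow hS).contDiffOn, (hv.contDiff_backFlow hS).contDiffOn, fun t ht =>
    ⟨hv.backFlow_flow t, hv.flow_backFlow t, hv.det_fderiv_flow_ne_zero hS t,
      hu.eq_comp_backFlow hg hM ht⟩⟩
  rw [← velocity_of_nonneg ht]
  exact (hv.hasDerivAt_flow ξ t).hasDerivWithinAt

end IsGlobalSolution

theorem theorem1 (n : ℕ) (g : RSpace n → ℝ) (hg : MemW11 g)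
    (u₀ : RSpace n → RSpace n) (hu₀ : ContDiff ℝ 1 u₀) (hb : ∃ M : ℝ, ∀ x, ‖u₀ x‖ ≤ M) :
    -- existence of a global solution
    (∃ u, IsGlobalSolution g u₀ u) ∧
    -- uniqueness, and persistence of the gradient bound, when the initial gradient is bounded
    ((∃ K : ℝ, ∀ x, ‖fderiv ℝ u₀ x‖ ≤ K) →
      (∀ u v, IsGlobalSolution g u₀ u → IsGlobalSolution g u₀ v → ∀ t, 0 ≤ t → u t = v t) ∧
      (∀ u, IsGlobalSolution g u₀ u →
        ∀ T : ℝ, ∃ K : ℝ, ∀ t ∈ Icc 0 T, ∀ x, ‖fderiv ℝ (u t) x‖ ≤ K)) ∧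
    -- structure of every global solution
    (∀ u, IsGlobalSolution g u₀ u →
      -- the flow of the filtered velocity, its inverse, its Jacobian, and the formula for `u`
      (∃ φ ψ : ℝ → RSpace n → RSpace n,
        IsFlow (fun t => filtered g (u t)) φ ∧ IsC1 φ ∧ IsC1 ψ ∧
        ∀ t, 0 ≤ t →
          Function.LeftInverse (ψ t) (φ t) ∧ Function.RightInverse (ψ t) (φ t) ∧
          (∀ ξ, (fderiv ℝ (φ t) ξ).det ≠ 0) ∧
          (∀ x, u t x = u₀ (ψ t x))) ∧
      -- conservation of the sup norm, for the vector field and for each component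
      (∀ t, 0 ≤ t →
        eLpNorm (u t) ∞ volume = eLpNorm u₀ ∞ volume ∧
        ∀ j : Fin n, eLpNorm (fun x => u t x j) ∞ volume = eLpNorm (fun x => u₀ x j) ∞ volume) ∧
      -- the bound on the gradient of the filtered velocity, for the vector and each component
      (∀ t, 0 ≤ t →
        ContDiff ℝ 1 (filtered g (u t)) ∧
        ∀ (i : Fin n) (h : RSpace n → ℝ), IsWeakPartial g i h →
          eLpNorm (fun x => fderiv ℝ (filtered g (u t)) x (basisVec i)) ∞ volume
            ≤ eLpNorm h 1 volume * eLpNorm u₀ ∞ volume ∧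
          ∀ j : Fin n,
            eLpNorm (fun x => fderiv ℝ (filtered g (u t)) x (basisVec i) j) ∞ volume
              ≤ eLpNorm h 1 volume * eLpNorm (fun x => u₀ x j) ∞ volume)) := by
  obtain ⟨M, hM⟩ := hb
  refine ⟨exists_isGlobalSolution hg hu₀ hM, ?_, fun u hu => ?_⟩
  · rintro ⟨K, hK⟩
    refine ⟨fun u v hu hv t ht => hu.unique hv hg hu₀ hM hK ht, fun u hu T => ?_⟩
    choose h hh using hg.2
    exact ⟨_, fun t ht x => hu.norm_fderiv_le hg hu₀ hh hM hK ht x⟩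
  · have hc := hu₀.continuous
    have hn : ∀ t, 0 ≤ t → eLpNorm (u t) ∞ volume = eLpNorm u₀ ∞ volume ∧
        ∀ j : Fin n, eLpNorm (fun x => u t x j) ∞ volume = eLpNorm (fun x => u₀ x j) ∞ volume :=
      fun t ht => ⟨hu.eLpNorm_top_comp_eq hg hM (p := id) hc ht, fun j =>
        hu.eLpNorm_top_comp_eq hg hM (p := fun y => y j) (by fun_prop) ht⟩
    refine ⟨hu.exists_flow hg hM, hn, fun t ht => ?_⟩
    have hut := hu.continuous_apply ht
    have hMt := fun x => hu.norm_le hg hM ht x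
    refine ⟨?_, fun i h hh => ⟨?_, fun j => ?_⟩⟩
    · choose h hh using hg.2
      exact contDiff_filtered hg.1 hh hut hMt
    · rw [← (hn t ht).1]
      exact eLpNorm_fderiv_filtered_le hg hh hut hMt
    · rw [← (hn t ht).2 j]
      exact eLpNorm_fderiv_filtered_coord_le hg hh hut hMt j
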